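/- **Definitions.** States are positive semidefinite operators of trace $1$ on a finite-dimensional complex Hilbert space; subnormalised states are positive semidefinite operators of trace at most $1$. All logarithms are to base $2$, $\log 0=-\infty$, $\log\infty=\infty$, $\inf\emptyset=\infty$, and $\le$ between operators is the Loewner order. For states $\rho,\sigma$ and $\delta\in[0,1]$ let $$D_H^{\delta}(\rho\|\sigma)=-\log\inf\{\operatorname{Tr}M\sigma : 0\le M\le \mathbb 1,\ \operatorname{Tr}(\mathbb 1-M)\rho\le\delta\},\qquad D_{\max}(\rho'\|\sigma)=\log\inf\{\lambda\ge 0:\rho'\le\lambda\sigma\}.$$ With $\|X\|_1=\operatorname{Tr}\sqrt{X^\dagger X}$, $\|\rho-\rho'\|_+=\tfrac12\|\rho-\rho'\|_1+\tfrac12\operatorname{Tr}(\rho-\rho')$, $F(\rho,\rho')=\|\sqrt{\rho}\sqrt{\rho'}\|_1^2$ and $P(\rho,\rho')=\sqrt{1-F(\rho,\rho')}$, define the smooth max-relative entropies as infima of $D_{\max}(\rho'\|\sigma)$: - $D_{\max}^{\delta,T,=}(\rho\|\sigma)$: over states $\rho'$ with $\tfrac12\|\rho-\rho'\|_1\le\delta$;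 - $D_{\max}^{\delta,T,\le}(\rho\|\sigma)$: over subnormalised states $\rho'$ with $\|\rho-\rho'\|_+\le\delta$; - $D_{\max}^{\delta,P,=}(\rho\|\sigma)$: over states $\rho'$ with $P(\rho,\rho')\le\delta$; - $D_{\max}^{\delta,P,\le}(\rho\|\sigma)$: over subnormalised states $\rho'$ with $P(\rho,\rho')\le\delta$. Finally let $F_2(p,q)=\big(\sqrt{pq}+\sqrt{(1-p)(1-q)}\big)^2$. **Theorem (tight weak/strong converse duality).** Let $0<\mu\le\varepsilon<1$. For all states $\rho,\sigma$ on the same finite-dimensional space, $$D_{\max}^{\sqrt\varepsilon,T,=}(\rho\|\sigma)+\log\tfrac1\varepsilon\ \le\ D_H^{1-\varepsilon}(\rho\|\sigma)\ \le\ D_{\max}^{\varepsilon-\mu,T,=}(\rho\|\sigma)+\log\tfrac1\mu, \tag{1}$$ $$D_{\max}^{\sqrt\varepsilon,P,=}(\rho\|\sigma)+\log\tfrac1\varepsilon\ \le\ D_H^{1-\varepsilon}(\rho\|\sigma)\ \le\ D_{\max}^{\sqrt{\varepsilon-\mu},P,=}(\rho\|\sigma)+\log\tfrac{F_2(1-\varepsilon,\varepsilon-\mu)}{\mu^2}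 \tag{2}$$ $$\le\ D_{\max}^{\sqrt{\varepsilon-\mu},P,=}(\rho\|\sigma)+\log\tfrac1{\mu^2}. \tag{3}$$ If moreover $\rho$ and $\sigma$ commute, then $$D_{\max}^{\varepsilon,T,=}(\rho\|\sigma)+\log\tfrac1\varepsilon\ \le\ D_H^{1-\varepsilon}(\rho\|\sigma)\ \le\ D_{\max}^{\varepsilon-\mu,T,=}(\rho\|\sigma)+\log\tfrac1\mu. \tag{4}$$ The bounds (1)–(4) also hold when normalised smoothing ($=$) is replaced everywhere by subnormalised smoothing ($\le$). The bounds (1), (2) and (4), with normalised smoothing, are tight: for all $0<\mu\le\varepsilon<1$ and for each of the two inequalities in (1), each of the two in (2), and each of the two in (4), there is a pair of states on $\mathbb C^2$ (commuting in the case of (4)) for which that inequality is an equality with both sides finite. -/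

import Mathlib

open scoped ENNReal NNReal

noncomputable section

namespace OneShot

open scoped MatrixOrder ComplexOrder

/-- The base-2 logarithm `[0, ∞] → [-∞, ∞]`, with `log 0 = -∞` and `log ∞ = ∞`. -/
def log2 (x : ℝ≥0∞) : EReal :=
  if x = 0 then ⊥ else if x = ⊤ then ⊤ else ((Real.logb 2 x.toReal : ℝ) : EReal)

/-- The binary fidelity `F₂(p, q)`. -/
def binaryFidelity (p q : ℝ) : ℝ :=
  (Real.sqrt (p * q) + Real.sqrt ((1 - p) * (1 - q))) ^ 2

variable {n : Type*} [Fintype n] [DecidableEq n]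

/-- Quantum states: positive semidefinite operators of trace one, written as matrices in an
orthonormal basis of the finite-dimensional Hilbert space. -/
structure IsState (ρ : Matrix n n ℂ) : Prop where
  posSemidef : ρ.PosSemidef
  trace_eq_one : ρ.trace = 1

/-- Subnormalised states: positive semidefinite operators of trace at most one. -/
structure IsSubstate (ρ : Matrix n n ℂ) : Prop where
  posSemidef : ρ.PosSemidef
  trace_le_one : ρ.trace.re ≤ 1

/-- The Schatten 1-norm `‖X‖₁ = Tr √(X† X)`. -/
def traceNorm (X : Matrix n n ℂ) : ℝ :=
  (CFC.sqrt (X.conjTranspose * X)).trace.re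

/-- The trace distance `½ ‖ρ - ρ'‖₁`. -/
def traceDist (ρ ρ' : Matrix n n ℂ) : ℝ :=
  traceNorm (ρ - ρ') / 2

/-- The generalised trace distance `‖ρ - ρ'‖₊ = ½ ‖ρ - ρ'‖₁ + ½ Tr (ρ - ρ')`. -/
def genTraceDist (ρ ρ' : Matrix n n ℂ) : ℝ :=
  traceNorm (ρ - ρ') / 2 + (ρ - ρ').trace.re / 2

/-- The Uhlmann fidelity `F(ρ, ρ') = ‖√ρ √ρ'‖₁²`. -/
def fidelity (ρ ρ' : Matrix n n ℂ) : ℝ :=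
  traceNorm (CFC.sqrt ρ * CFC.sqrt ρ') ^ 2

/-- The purified distance `P(ρ, ρ') = √(1 - F(ρ, ρ'))`. -/
def purifiedDist (ρ ρ' : Matrix n n ℂ) : ℝ :=
  Real.sqrt (1 - fidelity ρ ρ')

/-- Trace-distance ball of normalised states. -/
def ballT (ε : ℝ) (ρ : Matrix n n ℂ) : Set (Matrix n n ℂ) :=
  {ρ' | IsState ρ' ∧ traceDist ρ ρ' ≤ ε}

/-- Generalised-trace-distance ball of subnormalised states. -/
def ballTSub (ε : ℝ) (ρ : Matrix n n ℂ) : Set (Matrix n n ℂ) :=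
  {ρ' | IsSubstate ρ' ∧ genTraceDist ρ ρ' ≤ ε}

/-- Purified-distance ball of normalised states. -/
def ballP (ε : ℝ) (ρ : Matrix n n ℂ) : Set (Matrix n n ℂ) :=
  {ρ' | IsState ρ' ∧ purifiedDist ρ ρ' ≤ ε}

/-- Purified-distance ball of subnormalised states. -/
def ballPSub (ε : ℝ) (ρ : Matrix n n ℂ) : Set (Matrix n n ℂ) :=
  {ρ' | IsSubstate ρ' ∧ purifiedDist ρ ρ' ≤ ε}

/-- The max-relative entropy `log inf {λ ≥ 0 | ρ ≤ λ σ}` (Loewner order, `inf ∅ = ∞`). -/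
def Dmax (ρ σ : Matrix n n ℂ) : EReal :=
  log2 (⨅ (c : ℝ≥0) (_ : ρ ≤ ((c : ℝ) : ℂ) • σ), (c : ℝ≥0∞))

/-- `inf {Dmax ρ' σ | ρ' ∈ B}` over a smoothing neighbourhood `B`. -/
def infDmax (B : Set (Matrix n n ℂ)) (σ : Matrix n n ℂ) : EReal :=
  ⨅ ρ' ∈ B, Dmax ρ' σ

/-- Smooth max-relative entropy, trace distance, normalised smoothing. -/
def DmaxT (ε : ℝ) (ρ σ : Matrix n n ℂ) : EReal := infDmax (ballT ε ρ) σ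

/-- Smooth max-relative entropy, generalised trace distance, subnormalised smoothing. -/
def DmaxTSub (ε : ℝ) (ρ σ : Matrix n n ℂ) : EReal := infDmax (ballTSub ε ρ) σ

/-- Smooth max-relative entropy, purified distance, normalised smoothing. -/
def DmaxP (ε : ℝ) (ρ σ : Matrix n n ℂ) : EReal := infDmax (ballP ε ρ) σ

/-- Smooth max-relative entropy, purified distance, subnormalised smoothing. -/
def DmaxPSub (ε : ℝ) (ρ σ : Matrix n n ℂ) : EReal := infDmax (ballPSub ε ρ) σ

/-- The hypothesis testing relative entropy
`- log inf {Tr M σ | 0 ≤ M ≤ 1, Tr (1 - M) ρ ≤ ε}`. -/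
def DH (ε : ℝ) (ρ σ : Matrix n n ℂ) : EReal :=
  - log2 (⨅ (M : Matrix n n ℂ) (_ : 0 ≤ M ∧ M ≤ 1 ∧ ((1 - M) * ρ).trace.re ≤ ε),
      ENNReal.ofReal (M * σ).trace.re)

end OneShot

end

open OneShot

set_option linter.unusedSectionVars false

namespace OneShot

open scoped MatrixOrder ComplexOrder
open Matrix

/-! ### Traces, contractions and the variational formula for the trace norm. -/

section Toolbox

variable {m n : Type*} [Fintype m] [Fintype n]

/-! All bounds compare the tests `M` with `Tr Mρ ≥ ε` to the operators `τ` near `ρ`.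

Upper bounds: if `τ ≤ cσ` then `Tr Mτ ≤ c Tr Mσ`, so a constant `κ` with `κ ≤ Tr Mτ` for every such
test and every `τ` in the ball costs exactly `log (1/κ)` (`DH_le_infDmax_add`). For trace distance
`κ = μ`. For purified distance, monotonicity of fidelity under the test gives `κ = μ² / F₂(1 - ε, ε
- μ)` (`le_trace_of_mem_ballPSub`).

Lower bounds: let `β > 0` bound `Tr Nσ` from below over all such tests. It suffices to find a nearby
state `τ ≤ (ε/β)σ` (`infDmax_add_le_DH`). If no certified state were dominated, Hahn–Banach would
supply a positive `H` with `Tr Hτ > (ε/β) Tr Hσ` for every certified `τ`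
(`exists_mem_certifiedBall_le`). In the eigenbasis of `H` the problem is classical: truncate the
distribution of `ρ` at a multiple of that of `σ`, normalise, and lift back by reweighting `ρ`
(`exists_classical_smoothing`, `exists_mem_certifiedBall_trace_le`). This contradicts the
separation. Fuchs–van de Graaf then gives the trace-distance bound. When `ρ` and `σ` commute, their
minimum exists as an operator, which improves the radius from `√ε` to `ε`
(`exists_mem_ballT_le_of_commute`).

Tightness uses diagonal qubits with `σ` itself in the smoothing ball, so that the smoothed entropy
vanishes and only the logarithmic term remains. -/

lemma posSemidef_of_eq {A B : Matrix n n ℂ} (hB : B.PosSemidef) (h : A = B) : A.PosSemidef :=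
  h ▸ hB

lemma trace_conjTranspose_mul_self_re_nonneg (A : Matrix m n ℂ) : 0 ≤ (Aᴴ * A).trace.re :=
  (Complex.le_def.1 (posSemidef_conjTranspose_mul_self A).trace_nonneg).1

lemma trace_conjTranspose_re (A : Matrix n n ℂ) : Aᴴ.trace.re = A.trace.re := by
  simp [trace_conjTranspose]

/-- The Cauchy–Schwarz inequality for the Hilbert–Schmidt inner product. -/
lemma re_trace_conjTranspose_mul_le (A B : Matrix m n ℂ) :
    (Aᴴ * B).trace.re ≤ √(Aᴴ * A).trace.re * √(Bᴴ * B).trace.re := by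
  rw [← Real.sqrt_mul (trace_conjTranspose_mul_self_re_nonneg A)]
  apply Real.le_sqrt_of_sq_le
  have hBA : (Bᴴ * A).trace.re = (Aᴴ * B).trace.re := by
    rw [← trace_conjTranspose_re (Bᴴ * A)]; simp
  have key : ∀ s : ℝ, 0 ≤ (Aᴴ * A).trace.re * (s * s) + (-2 * (Aᴴ * B).trace.re) * s
      + (Bᴴ * B).trace.re := by
    intro s
    have h := trace_conjTranspose_mul_self_re_nonneg ((s : ℂ) • A - B)
    have : (((s : ℂ) • A - B)ᴴ * ((s : ℂ) • A - B)).trace.re = (Aᴴ * A).trace.re * (s * s)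
        + (-2 * (Aᴴ * B).trace.re) * s + (Bᴴ * B).trace.re := by
      simp [Matrix.sub_mul, Matrix.mul_sub, hBA]
      ring
    linarith
  have := discrim_le_zero key
  rw [discrim] at this
  nlinarith

variable [DecidableEq m] [DecidableEq n]

lemma sqrt_posSemidef (A : Matrix n n ℂ) : (CFC.sqrt A).PosSemidef :=
  nonneg_iff_posSemidef.1 (CFC.sqrt_nonneg A)

lemma sqrt_mul_sqrt {A : Matrix n n ℂ} (hA : A.PosSemidef) : CFC.sqrt A * CFC.sqrt A = A :=
  CFC.sqrt_mul_sqrt_self A (nonneg_iff_posSemidef.2 hA)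

lemma conjTranspose_sqrt (A : Matrix n n ℂ) : (CFC.sqrt A)ᴴ = CFC.sqrt A :=
  (sqrt_posSemidef A).isHermitian

lemma re_trace_mul_nonneg {A B : Matrix n n ℂ} (hA : A.PosSemidef) (hB : B.PosSemidef) :
    0 ≤ (A * B).trace.re := by
  have h := (hA.conjTranspose_mul_mul_same (CFC.sqrt B)).trace_nonneg
  rw [conjTranspose_sqrt, trace_mul_comm, ← Matrix.mul_assoc, sqrt_mul_sqrt hB, trace_mul_comm] at h
  exact (Complex.le_def.1 h).1

lemma re_trace_mul_mono {A B C : Matrix n n ℂ} (hC : C.PosSemidef) (h : A ≤ B) :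
    (C * A).trace.re ≤ (C * B).trace.re := by
  have := re_trace_mul_nonneg hC (le_iff.1 h)
  simp [mul_sub] at this
  exact this

lemma re_trace_mul_mono' {A B C : Matrix n n ℂ} (hC : C.PosSemidef) (h : A ≤ B) :
    (A * C).trace.re ≤ (B * C).trace.re := by
  rw [trace_mul_comm A, trace_mul_comm B]
  exact re_trace_mul_mono hC h

/-- The adjoint of a contraction is a contraction. -/
lemma mul_conjTranspose_le_one {U : Matrix m n ℂ} (hU : Uᴴ * U ≤ 1) : U * Uᴴ ≤ 1 := by
  rw [le_iff] at hU ⊢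
  have h1 := hU.mul_mul_conjTranspose_same U
  have h2 := posSemidef_conjTranspose_mul_self (1 - U * Uᴴ)
  refine posSemidef_of_eq (h2.add h1) ?_
  simp only [conjTranspose_sub, conjTranspose_one, conjTranspose_mul, conjTranspose_conjTranspose,
    Matrix.sub_mul, Matrix.mul_sub, Matrix.one_mul, Matrix.mul_one, Matrix.mul_assoc]
  abel

lemma re_trace_conj_le {Y : Matrix n n ℂ} (hY : Y.PosSemidef) {U : Matrix n m ℂ}
    (hU : Uᴴ * U ≤ 1) : (Uᴴ * Y * U).trace.re ≤ Y.trace.re := by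
  have h := re_trace_mul_mono hY (mul_conjTranspose_le_one hU)
  rw [Matrix.mul_one, ← Matrix.mul_assoc, trace_mul_comm, ← Matrix.mul_assoc] at h
  exact h

/-- Polar decomposition, with a contraction in place of the partial isometry. -/
lemma exists_polar (A : Matrix m n ℂ) :
    ∃ U : Matrix m n ℂ, Uᴴ * U ≤ 1 ∧ A = U * CFC.sqrt (Aᴴ * A) ∧ Uᴴ * A = CFC.sqrt (Aᴴ * A) := by
  set T := Aᴴ * A with hT
  have hTp : T.PosSemidef := posSemidef_conjTranspose_mul_self A
  have hT0 : 0 ≤ T := nonneg_iff_posSemidef.2 hTp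
  have hTs : IsSelfAdjoint T := hTp.isHermitian
  have hc : ∀ f : ℝ → ℝ, ContinuousOn f (spectrum ℝ T) := fun f =>
    T.finite_real_spectrum.continuousOn f
  have hpos : ∀ x ∈ spectrum ℝ T, 0 ≤ x := fun x hx => spectrum_nonneg_of_nonneg hT0 hx
  have hsq : CFC.sqrt T = cfc Real.sqrt T := by
    rw [CFC.sqrt_eq_real_sqrt T hT0,
      cfcₙ_eq_cfc (hf := Real.continuous_sqrt.continuousOn) (hf0 := by simp)]
  have hid : cfc (fun x : ℝ => x) T = T := cfc_id' ℝ T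
  -- Since `0⁻¹ = 0`, this is the pseudo-inverse square root, and `P` below is the support
  -- projection of `T`.
  set f : ℝ → ℝ := fun x => (√x)⁻¹
  set F := cfc f T
  set P := cfc (fun x : ℝ => f x * √x) T
  have hFh : Fᴴ = F := (cfc_predicate f T : IsSelfAdjoint F)
  have hFT : F * T = CFC.sqrt T := by
    rw [hsq]
    conv_lhs => rw [← hid]
    rw [← cfc_mul _ _ T (hc _) (hc _)]
    apply cfc_congr
    intro x hx
    have := hpos x hx
    rcases eq_or_lt_of_le this with h | h
    · simp [← h]
    · have h2 : √x ≠ 0 := (Real.sqrt_pos.2 h).ne'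
      simp only [f]
      field_simp
      rw [Real.sq_sqrt h.le]
  have hTP : T * P = T := by
    nth_rw 1 [← hid]
    rw [← cfc_mul _ _ T (hc _) (hc _)]
    conv_rhs => rw [← hid]
    apply cfc_congr
    intro x hx
    rcases eq_or_lt_of_le (hpos x hx) with h | h
    · simp [← h]
    · have h2 : √x ≠ 0 := (Real.sqrt_pos.2 h).ne'
      simp [f, h2]
  refine ⟨A * F, ?_, ?_, ?_⟩
  · have : (A * F)ᴴ * (A * F) = P := by
      rw [conjTranspose_mul, hFh, Matrix.mul_assoc, ← Matrix.mul_assoc Aᴴ, ← hT, ← Matrix.mul_assoc, hFT,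
        hsq,        ← cfc_mul _ _ T (hc _) (hc _)]
      simp only [P, mul_comm]
    rw [this]
    apply cfc_le_one
    intro x hx
    by_cases h2 : √x = 0
    · simp [f, h2]
    · simp [f, h2]
  · have hAP : A * (1 - P) = 0 := by
      rw [← conjTranspose_mul_self_eq_zero, conjTranspose_mul, Matrix.mul_assoc, ← Matrix.mul_assoc Aᴴ, ← hT,
        Matrix.mul_sub, hTP]
      simp
    rw [Matrix.mul_assoc, hsq, ← cfc_mul _ _ T (hc _) (hc _)]
    rw [Matrix.mul_sub, Matrix.mul_one, sub_eq_zero] at hAP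
    exact hAP
  · rw [conjTranspose_mul, hFh, Matrix.mul_assoc, ← hT, hFT]

lemma re_trace_mul_le_traceNorm {W X : Matrix n n ℂ} (hW : Wᴴ * W ≤ 1) :
    (W * X).trace.re ≤ traceNorm X := by
  obtain ⟨U, hU, hX, -⟩ := exists_polar X
  set S := CFC.sqrt (Xᴴ * X) with hS
  have hSp : S.PosSemidef := sqrt_posSemidef _
  -- Splitting `S = R * R` lets Cauchy–Schwarz bound the trace by `Tr S`, because `W` and `U` are
  -- contractions.
  set R := CFC.sqrt S
  have hR : R * R = S := sqrt_mul_sqrt hSp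
  have hRh : Rᴴ = R := conjTranspose_sqrt S
  have h1 := re_trace_conjTranspose_mul_le R (W * U * R)
  have e1 : (Rᴴ * (W * U * R)).trace = (W * X).trace := by
    rw [hRh, trace_mul_comm, hX, Matrix.mul_assoc, hR, Matrix.mul_assoc]
  have e2 : ((W * U * R)ᴴ * (W * U * R)).trace.re ≤ S.trace.re := by
    have a := re_trace_mul_mono' (A := Wᴴ * W) (B := 1)
      ((posSemidef_self_mul_conjTranspose (U * R))) hW
    have b := re_trace_mul_mono' (A := Uᴴ * U) (B := 1) hSp hU
    have c : ((W * U * R)ᴴ * (W * U * R)).trace = (Wᴴ * W * (U * R * (U * R)ᴴ)).trace := by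
      rw [← Matrix.mul_assoc (Wᴴ * W), trace_mul_comm _ (U * R)ᴴ]
      simp only [conjTranspose_mul, Matrix.mul_assoc]
    have d : (1 * (U * R * (U * R)ᴴ)).trace = (Uᴴ * U * S).trace := by
      rw [one_mul, trace_mul_comm, conjTranspose_mul, hRh, Matrix.mul_assoc, trace_mul_comm, ← hR]
      simp only [Matrix.mul_assoc]
    rw [c]
    rw [d] at a
    rw [one_mul] at b
    exact a.trans b
  rw [e1, hRh, hR] at h1
  have h0 : 0 ≤ S.trace.re := (Complex.le_def.1 hSp.trace_nonneg).1
  calc _ ≤ _ := h1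
    _ ≤ √S.trace.re * √S.trace.re := by gcongr
    _ = _ := by rw [Real.mul_self_sqrt h0]; rfl

lemma traceNorm_nonneg (X : Matrix n n ℂ) : 0 ≤ traceNorm X :=
  (Complex.le_def.1 (sqrt_posSemidef _).trace_nonneg).1

/-- The operator `2M - 1` is a contraction, since `1 - (2M - 1)² = 4(M - M²)` and `M - M² = (1 -
M)M(1 - M) + M(1 - M)M`. -/
lemma re_trace_mul_le_genTrace {M H : Matrix n n ℂ} (hM0 : 0 ≤ M) (hM1 : M ≤ 1) :
    (M * H).trace.re ≤ traceNorm H / 2 + H.trace.re / 2 := by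
  have hM := nonneg_iff_posSemidef.1 hM0
  have hMh : Mᴴ = M := hM.isHermitian
  have h : ((2 : ℂ) • M - 1)ᴴ * ((2 : ℂ) • M - 1) ≤ 1 := by
    have h2 : (M - M * M).PosSemidef := by
      have a := hM.mul_mul_conjTranspose_same (1 - M)
      have b := (le_iff.1 hM1).mul_mul_conjTranspose_same M
      refine posSemidef_of_eq (a.add b) ?_
      simp only [conjTranspose_sub, conjTranspose_one, hMh]
      noncomm_ring
    rw [le_iff]
    refine posSemidef_of_eq (h2.smul (show (0 : ℂ) ≤ 4 by norm_num)) ?_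
    simp only [conjTranspose_sub, conjTranspose_smul, conjTranspose_one, hMh, star_ofNat]
    simp only [two_smul, sub_mul, mul_sub, add_mul, mul_add, one_mul, mul_one]
    rw [show (4 : ℂ) = 2 + 2 by norm_num, add_smul, two_smul]
    abel
  have := re_trace_mul_le_traceNorm (X := H) h
  simp [sub_mul] at this
  linarith

/-- The variational formula for the positive part of a Hermitian matrix is attained. -/
lemma exists_test_traceNorm {H : Matrix n n ℂ} (hH : H.IsHermitian) :
    ∃ M : Matrix n n ℂ, 0 ≤ M ∧ M ≤ 1 ∧
      (M * H).trace.re = traceNorm H / 2 + H.trace.re / 2 := by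
  obtain ⟨U, hU, -, hUH⟩ := exists_polar H
  have hU' := mul_conjTranspose_le_one hU
  have hS : ((Uᴴ) * H).trace.re = traceNorm H := by rw [hUH]; rfl
  have hS' : (U * H).trace.re = traceNorm H := by
    rw [← hS, ← trace_conjTranspose_re, conjTranspose_mul, hH.eq, trace_mul_comm]
  rw [le_iff] at hU hU'
  have e : (1 / 4 : ℂ) = ((1 / 4 : ℝ) : ℂ) := by norm_num
  have p4 : (0 : ℂ) ≤ 1 / 4 := by rw [e]; exact_mod_cast (by norm_num : (0 : ℝ) ≤ 1 / 4)
  -- This is `(1 + Re U)/2` with `U` the polar contraction, a sign of `H`. Both operator bounds come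
  -- from `2 ± (U + Uᴴ) = (1 ± U)ᴴ(1 ± U) + (1 - UᴴU)`.
  refine ⟨(1 / 4 : ℂ) • (1 + 1 + (U + Uᴴ)), ?_, ?_, ?_⟩
  · rw [nonneg_iff_posSemidef]
    refine PosSemidef.smul ?_ p4
    refine posSemidef_of_eq ((posSemidef_conjTranspose_mul_self (1 + U)).add hU) ?_
    simp only [conjTranspose_add, conjTranspose_one]
    noncomm_ring
  · rw [le_iff]
    have h1 := ((posSemidef_conjTranspose_mul_self (1 - U)).add hU).smul p4
    refine posSemidef_of_eq h1 ?_
    have : (1 : Matrix n n ℂ) = (1 / 4 : ℂ) • (1 + 1 + (1 + 1)) := by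
      rw [← two_smul ℂ (1 : Matrix n n ℂ), ← add_smul, smul_smul]; norm_num
    nth_rw 1 [this]
    rw [← smul_sub]
    simp only [conjTranspose_sub, conjTranspose_one]
    noncomm_ring
  · have : ((1 / 4 : ℂ)) = ((1 / 4 : ℝ) : ℂ) := by norm_num
    rw [this]
    simp only [smul_mul, trace_smul, add_mul, trace_add, one_mul, smul_eq_mul, Complex.re_ofReal_mul,
      Complex.add_re, hS, hS']
    ring

end Toolbox

/-! ### Fidelity, smoothing balls and what a test sees of a nearby state. -/

section Fidelity

variable {n : Type*} [Fintype n] [DecidableEq n]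

/-- Cauchy–Schwarz applied to `√N √ρ U` and `√N √τ`; the contraction `U` can only decrease the first
norm. -/
lemma re_trace_sqrt_mul_le {N ρ τ U : Matrix n n ℂ} (hN : N.PosSemidef) (hρ : ρ.PosSemidef)
    (hτ : τ.PosSemidef) (hU : Uᴴ * U ≤ 1) :
    (Uᴴ * (CFC.sqrt ρ * N * CFC.sqrt τ)).trace.re
      ≤ √(N * ρ).trace.re * √(N * τ).trace.re := by
  set K := CFC.sqrt N
  have hK : K * K = N := sqrt_mul_sqrt hN
  have hKh : Kᴴ = K := conjTranspose_sqrt N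
  set R := CFC.sqrt ρ
  have hR : R * R = ρ := sqrt_mul_sqrt hρ
  have hRh : Rᴴ = R := conjTranspose_sqrt ρ
  set S := CFC.sqrt τ
  have hS : S * S = τ := sqrt_mul_sqrt hτ
  have hSh : Sᴴ = S := conjTranspose_sqrt τ
  have h := re_trace_conjTranspose_mul_le (K * R * U) (K * S)
  have e1 : (K * R * U)ᴴ * (K * S) = Uᴴ * (R * N * S) := by
    rw [← hK]; simp only [conjTranspose_mul, hKh, hRh, mul_assoc]
  have e2 : ((K * R * U)ᴴ * (K * R * U)).trace.re ≤ (N * ρ).trace.re := by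
    have h2 := re_trace_conj_le (posSemidef_conjTranspose_mul_self (K * R)) hU
    have a1 : (K * R * U)ᴴ * (K * R * U) = Uᴴ * ((K * R)ᴴ * (K * R)) * U := by
      simp only [conjTranspose_mul, mul_assoc]
    have a2 : ((K * R)ᴴ * (K * R)).trace = (N * ρ).trace := by
      rw [conjTranspose_mul, hKh, hRh, mul_assoc, trace_mul_comm, ← hR, ← hK]
      simp only [mul_assoc]
    rwa [a1, ← a2]
  have e3 : ((K * S)ᴴ * (K * S)).trace = (N * τ).trace := by
    rw [conjTranspose_mul, hKh, hSh, mul_assoc, trace_mul_comm, ← hS, ← hK]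
    simp only [mul_assoc]
  rw [e1, e3] at h
  exact h.trans (by gcongr)

/-- Monotonicity of the root fidelity under two-outcome measurements. -/
lemma traceNorm_sqrt_mul_sqrt_le {M ρ τ : Matrix n n ℂ} (hM0 : 0 ≤ M) (hM1 : M ≤ 1)
    (hρ : ρ.PosSemidef) (hτ : τ.PosSemidef) :
    traceNorm (CFC.sqrt ρ * CFC.sqrt τ) ≤ √(M * ρ).trace.re * √(M * τ).trace.re +
      √((1 - M) * ρ).trace.re * √((1 - M) * τ).trace.re := by
  obtain ⟨U, hU, -, hUX⟩ := exists_polar (CFC.sqrt ρ * CFC.sqrt τ)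
  have h1 := re_trace_sqrt_mul_le (nonneg_iff_posSemidef.1 hM0) hρ hτ hU
  have h2 := re_trace_sqrt_mul_le (le_iff.1 hM1) hρ hτ hU
  have h3 : traceNorm (CFC.sqrt ρ * CFC.sqrt τ) =
      (Uᴴ * (CFC.sqrt ρ * M * CFC.sqrt τ)).trace.re +
        (Uᴴ * (CFC.sqrt ρ * (1 - M) * CFC.sqrt τ)).trace.re := by
    rw [traceNorm, ← hUX, ← Complex.add_re, ← trace_add, ← mul_add, ← add_mul, ← mul_add]
    simp
  rw [h3]
  exact add_le_add h1 h2

/-- The easy direction of Uhlmann's theorem in semidefinite-programming form. -/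
lemma re_trace_le_of_fromBlocks {ρ τ Z : Matrix n n ℂ}
    (h : (fromBlocks ρ Z Zᴴ τ).PosSemidef) :
    Z.trace.re ≤ traceNorm (CFC.sqrt ρ * CFC.sqrt τ) := by
  -- The block matrix is a Gram matrix: its two column blocks `A`, `B` act as purifications of `ρ`
  -- and `τ` with overlap `Zᴴ`. Polar decomposition turns the overlap into a contraction against `√ρ
  -- √τ`.
  set C := CFC.sqrt (fromBlocks ρ Z Zᴴ τ)
  have hC : Cᴴ * C = fromBlocks ρ Z Zᴴ τ := by
    rw [conjTranspose_sqrt]; exact sqrt_mul_sqrt h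
  set A := C.submatrix id (Sum.inl : n → n ⊕ n)
  set B := C.submatrix id (Sum.inr : n → n ⊕ n)
  have hA : Aᴴ * A = ρ := by
    ext i j
    have := congrFun (congrFun hC (Sum.inl i)) (Sum.inl j)
    rwa [fromBlocks_apply₁₁] at this
  have hB : Bᴴ * B = τ := by
    ext i j
    have := congrFun (congrFun hC (Sum.inr i)) (Sum.inr j)
    rwa [fromBlocks_apply₂₂] at this
  have hZ : Bᴴ * A = Zᴴ := by
    ext i j
    have := congrFun (congrFun hC (Sum.inr i)) (Sum.inl j)
    rwa [fromBlocks_apply₂₁] at this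
  obtain ⟨U, hU, hAU, -⟩ := exists_polar A
  obtain ⟨V, hV, hBV, -⟩ := exists_polar B
  rw [hA] at hAU
  rw [hB] at hBV
  have hW : (Vᴴ * U)ᴴ * (Vᴴ * U) ≤ 1 := by
    have h1 := (le_iff.1 (mul_conjTranspose_le_one hV)).conjTranspose_mul_mul_same U
    refine posSemidef_of_eq ((le_iff.1 hU).add h1) ?_
    simp only [conjTranspose_mul, conjTranspose_conjTranspose, Matrix.mul_sub, Matrix.sub_mul,
      Matrix.mul_one, Matrix.mul_assoc]
    abel
  calc Z.trace.re = (Bᴴ * A).trace.re := by rw [hZ, trace_conjTranspose_re]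
    _ = (Vᴴ * U * (CFC.sqrt ρ * CFC.sqrt τ)).trace.re := by
      rw [hBV, hAU, conjTranspose_mul, conjTranspose_sqrt, Matrix.mul_assoc, trace_mul_comm]
      simp only [Matrix.mul_assoc]
    _ ≤ _ := re_trace_mul_le_traceNorm hW

lemma le_one_of_isSubstate_trace {M τ : Matrix n n ℂ} (hM0 : 0 ≤ M) (hM1 : M ≤ 1)
    (hτ : IsSubstate τ) :
    0 ≤ (M * τ).trace.re ∧ (M * τ).trace.re ≤ 1 ∧
      ((1 - M) * τ).trace.re ≤ 1 - (M * τ).trace.re := by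
  have h0 := re_trace_mul_nonneg (nonneg_iff_posSemidef.1 hM0) hτ.posSemidef
  have h1 := re_trace_mul_nonneg (le_iff.1 hM1) hτ.posSemidef
  have h2 := hτ.trace_le_one
  simp only [sub_mul, one_mul, trace_sub, Complex.sub_re] at h1 ⊢
  exact ⟨h0, by linarith, by linarith⟩

lemma IsState.isSubstate {ρ : Matrix n n ℂ} (h : IsState ρ) : IsSubstate ρ :=
  ⟨h.posSemidef, by simp [h.trace_eq_one]⟩

lemma re_trace_one_sub_mul {M ρ : Matrix n n ℂ} (hρ : IsState ρ) :
    ((1 - M) * ρ).trace.re = 1 - (M * ρ).trace.re := by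
  simp [sub_mul, hρ.trace_eq_one]

/-- The root fidelity is bounded by the root fidelity of the outcomes of a test. -/
lemma traceNorm_le_binary {M ρ τ : Matrix n n ℂ} (hM0 : 0 ≤ M) (hM1 : M ≤ 1)
    (hρ : IsState ρ) (hτ : IsSubstate τ) :
    traceNorm (CFC.sqrt ρ * CFC.sqrt τ) ≤ √(M * ρ).trace.re * √(M * τ).trace.re +
      √(1 - (M * ρ).trace.re) * √(1 - (M * τ).trace.re) := by
  have h := traceNorm_sqrt_mul_sqrt_le hM0 hM1 hρ.posSemidef hτ.posSemidef
  rw [re_trace_one_sub_mul hρ] at h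
  have := (le_one_of_isSubstate_trace hM0 hM1 hτ).2.2
  exact h.trans (by gcongr)

/-- The Fuchs–van de Graaf inequality. -/
lemma traceDist_le_purifiedDist {ρ τ : Matrix n n ℂ} (hρ : IsState ρ) (hτ : IsState τ) :
    traceDist ρ τ ≤ purifiedDist ρ τ := by
  obtain ⟨M, hM0, hM1, hM⟩ := exists_test_traceNorm
    (hρ.posSemidef.isHermitian.sub hτ.posSemidef.isHermitian)
  have ht : (ρ - τ).trace = 0 := by simp [hρ.trace_eq_one, hτ.trace_eq_one]
  rw [ht, mul_sub, trace_sub, Complex.sub_re] at hM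
  simp only [Complex.zero_re, zero_div, add_zero] at hM
  have hF := traceNorm_le_binary hM0 hM1 hρ hτ.isSubstate
  obtain ⟨p0, p1, -⟩ := le_one_of_isSubstate_trace hM0 hM1 hρ.isSubstate
  obtain ⟨q0, q1, -⟩ := le_one_of_isSubstate_trace hM0 hM1 hτ.isSubstate
  rw [traceDist, ← hM, purifiedDist]
  apply Real.le_sqrt_of_sq_le
  set p := (M * ρ).trace.re
  set q := (M * τ).trace.re
  have hF2 : fidelity ρ τ ≤ (√p * √q + √(1 - p) * √(1 - q)) ^ 2 := by
    have := traceNorm_nonneg (CFC.sqrt ρ * CFC.sqrt τ)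
    rw [fidelity]
    gcongr
  have a := Real.sq_sqrt p0
  have b := Real.sq_sqrt q0
  have c := Real.sq_sqrt (sub_nonneg.2 p1)
  have d := Real.sq_sqrt (sub_nonneg.2 q1)
  set x := √p
  set y := √q
  set z := √(1 - p)
  set w := √(1 - q)
  -- With `x, z = sin α, cos α` and `y, w = sin β, cos β`, the following facts are `cos² + sin² = 1`
  -- at `α - β`, the identity `sin² α - sin² β = sin(α - β) sin(α + β)`, and `sin² (α + β) ≤ 1`.
  have e1 : (x * y + z * w) ^ 2 + (x * w - y * z) ^ 2 = 1 := by
    have : (x * y + z * w) ^ 2 + (x * w - y * z) ^ 2 = (x ^ 2 + z ^ 2) * (y ^ 2 + w ^ 2) := by ring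
    rw [this, a, b, c, d]; ring
  have e2 : p - q = (x * w - y * z) * (x * w + y * z) := by
    have : (x * w - y * z) * (x * w + y * z) = x ^ 2 * w ^ 2 - y ^ 2 * z ^ 2 := by ring
    rw [this, a, b, c, d]; ring
  have e3 : (x * w + y * z) ^ 2 ≤ 1 := by
    have : (x * w + y * z) ^ 2 + (x * y - z * w) ^ 2 = (x ^ 2 + z ^ 2) * (y ^ 2 + w ^ 2) := by ring
    rw [a, b, c, d] at this
    nlinarith [sq_nonneg (x * y - z * w)]
  have e4 : (p - q) ^ 2 ≤ (x * w - y * z) ^ 2 := by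
    rw [e2, mul_pow]
    exact mul_le_of_le_one_right (sq_nonneg _) e3
  linarith

lemma le_fidelity_of_fromBlocks {ρ τ Z : Matrix n n ℂ} {a : ℝ} (ha : 0 ≤ a)
    (h : (fromBlocks ρ Z Zᴴ τ).PosSemidef) (hZ : √a ≤ Z.trace.re) : a ≤ fidelity ρ τ := by
  have h1 := hZ.trans (re_trace_le_of_fromBlocks h)
  rw [fidelity, ← Real.sq_sqrt ha]
  gcongr

lemma purifiedDist_le_sqrt_iff {ρ τ : Matrix n n ℂ} {a : ℝ} (ha : 0 ≤ a) :
    purifiedDist ρ τ ≤ √a ↔ 1 - a ≤ fidelity ρ τ := by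
  rw [purifiedDist, Real.sqrt_le_sqrt_iff ha]
  constructor <;> intro h <;> linarith

lemma ballT_subset_ballTSub (ε : ℝ) {ρ : Matrix n n ℂ} (hρ : IsState ρ) :
    ballT ε ρ ⊆ ballTSub ε ρ := by
  rintro τ ⟨hτ, h⟩
  refine ⟨hτ.isSubstate, ?_⟩
  rw [genTraceDist]
  rw [traceDist] at h
  simpa [hρ.trace_eq_one, hτ.trace_eq_one] using h

lemma ballP_subset_ballPSub (ε : ℝ) (ρ : Matrix n n ℂ) : ballP ε ρ ⊆ ballPSub ε ρ :=
  fun _ h => ⟨h.1.isSubstate, h.2⟩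

lemma ballP_subset_ballT (ε : ℝ) {ρ : Matrix n n ℂ} (hρ : IsState ρ) :
    ballP ε ρ ⊆ ballT ε ρ :=
  fun _ h => ⟨h.1, (traceDist_le_purifiedDist hρ h.1).trans h.2⟩

lemma infDmax_anti {A B : Set (Matrix n n ℂ)} (h : A ⊆ B) (σ : Matrix n n ℂ) :
    infDmax B σ ≤ infDmax A σ :=
  biInf_mono h

lemma le_trace_of_mem_ballTSub {ε μ : ℝ} {M ρ τ : Matrix n n ℂ} (hM0 : 0 ≤ M) (hM1 : M ≤ 1)
    (hM : ε ≤ (M * ρ).trace.re) (hτ : τ ∈ ballTSub (ε - μ) ρ) : μ ≤ (M * τ).trace.re := by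
  have h1 := re_trace_mul_le_genTrace (H := ρ - τ) hM0 hM1
  have h2 := hτ.2
  rw [genTraceDist] at h2
  rw [mul_sub, trace_sub, Complex.sub_re] at h1
  linarith

/-- Three unit vectors in the plane: rotating `(x, y)` by `(s, c)` gives first coordinate at least
`d`, hence second coordinate at least `-e`; rotating back recovers `x`. -/
lemma sub_le_of_le_add_rotation {s c x y d e : ℝ} (hs : 0 ≤ s) (hc : 0 ≤ c) (hd : 0 ≤ d)
    (he : 0 ≤ e) (hsc : s ^ 2 + c ^ 2 = 1) (hxy : x ^ 2 + y ^ 2 = 1) (hde : d ^ 2 + e ^ 2 = 1)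
    (h : d ≤ s * x + c * y) : s * d - c * e ≤ x := by
  have h1 : (s * x + c * y) ^ 2 + (c * x - s * y) ^ 2 = 1 := by
    have : (s * x + c * y) ^ 2 + (c * x - s * y) ^ 2 = (s ^ 2 + c ^ 2) * (x ^ 2 + y ^ 2) := by ring
    rw [this, hsc, hxy, one_mul]
  have h2 : d ^ 2 ≤ (s * x + c * y) ^ 2 := by gcongr
  have h3 : -e ≤ c * x - s * y := (abs_le_of_sq_le_sq' (by linarith) he).1
  have h4 : x = s * (s * x + c * y) + c * (c * x - s * y) := by linear_combination -x * hsc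
  have h5 := mul_le_mul_of_nonneg_left h hs
  have h6 := mul_le_mul_of_nonneg_left h3 hc
  linarith

lemma binaryFidelity_eq {ε μ : ℝ} (hμ : 0 ≤ μ) (hμε : μ ≤ ε) (hε : ε ≤ 1) :
    binaryFidelity (1 - ε) (ε - μ) = (√ε * √(1 - ε + μ) + √(1 - ε) * √(ε - μ)) ^ 2 := by
  rw [binaryFidelity, Real.sqrt_mul (by linarith), Real.sqrt_mul (by linarith), sub_sub_cancel,
    show 1 - (ε - μ) = 1 - ε + μ by ring, add_comm]

lemma binaryFidelity_pos {ε μ : ℝ} (hμ : 0 < μ) (hμε : μ ≤ ε) (hε : ε ≤ 1) :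
    0 < binaryFidelity (1 - ε) (ε - μ) := by
  rw [binaryFidelity_eq hμ.le hμε hε]
  have h1 : 0 < √ε := Real.sqrt_pos.2 (by linarith)
  have h2 : 0 < √(1 - ε + μ) := Real.sqrt_pos.2 (by linarith)
  positivity

/-- A difference of squares, used to identify the least amplitude allowed by the rotation bound as
`μ / √F₂`. -/
lemma sqrt_rotation_mul {ε μ : ℝ} (hμ : 0 ≤ μ) (hμε : μ ≤ ε) (hε : ε ≤ 1) :
    (√ε * √(1 - ε + μ) - √(1 - ε) * √(ε - μ)) * (√ε * √(1 - ε + μ) + √(1 - ε) * √(ε - μ)) = μ := by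
  have a := Real.sq_sqrt (show 0 ≤ ε by linarith)
  have b := Real.sq_sqrt (show 0 ≤ 1 - ε by linarith)
  have c := Real.sq_sqrt (show 0 ≤ 1 - ε + μ by linarith)
  have d := Real.sq_sqrt (show 0 ≤ ε - μ by linarith)
  have : ∀ x y z w : ℝ, (x * y - z * w) * (x * y + z * w) = x ^ 2 * y ^ 2 - z ^ 2 * w ^ 2 :=
    fun x y z w => by ring
  rw [this, a, b, c, d]
  ring

lemma le_trace_of_mem_ballPSub {ε μ : ℝ} (hμ : 0 < μ) (hμε : μ ≤ ε) (hε : ε < 1)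
    {M ρ τ : Matrix n n ℂ} (hM0 : 0 ≤ M) (hM1 : M ≤ 1) (hρ : IsState ρ)
    (hM : ε ≤ (M * ρ).trace.re) (hτ : τ ∈ ballPSub (√(ε - μ)) ρ) :
    μ ^ 2 / binaryFidelity (1 - ε) (ε - μ) ≤ (M * τ).trace.re := by
  obtain ⟨hτ, hP⟩ := hτ
  rw [purifiedDist_le_sqrt_iff (by linarith)] at hP
  set p := (M * ρ).trace.re with hp
  have hp0 : 0 < p := by linarith
  have hr0 : 0 ≤ ε / p := div_nonneg (by linarith) hp0.le
  have hr1 : ε / p ≤ 1 := (div_le_one hp0).2 hM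
  have hMp := nonneg_iff_posSemidef.1 hM0
  -- Shrinking the test makes its acceptance probability on `ρ` exactly `ε`, so the rotation angle
  -- is fixed; acceptance on `τ` only drops.
  set N : Matrix n n ℂ := ((ε / p : ℝ) : ℂ) • M with hN
  have hN0 : 0 ≤ N := nonneg_iff_posSemidef.2 (hMp.smul (by exact_mod_cast hr0))
  have hNM : N ≤ M := by
    rw [le_iff]
    refine posSemidef_of_eq (hMp.smul (a := ((1 - ε / p : ℝ) : ℂ)) ?_) ?_
    · exact_mod_cast sub_nonneg.2 hr1
    · rw [hN, Complex.ofReal_sub, sub_smul, Complex.ofReal_one, one_smul]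
  have hN1 : N ≤ 1 := hNM.trans hM1
  have hNρ : (N * ρ).trace.re = ε := by
    rw [hN, smul_mul, trace_smul, smul_eq_mul, Complex.re_ofReal_mul, ← hp]
    field_simp
  have hF := traceNorm_le_binary hN0 hN1 hρ hτ
  rw [hNρ] at hF
  obtain ⟨q0, q1, -⟩ := le_one_of_isSubstate_trace hN0 hN1 hτ
  have hNτ := re_trace_mul_mono' hτ.posSemidef hNM
  refine le_trans ?_ hNτ
  set q := (N * τ).trace.re
  have hd : √(1 - ε + μ) ≤ √ε * √q + √(1 - ε) * √(1 - q) := by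
    refine le_trans ?_ hF
    rw [Real.sqrt_le_left (traceNorm_nonneg _)]
    rw [fidelity] at hP
    linarith
  have hx := sub_le_of_le_add_rotation (Real.sqrt_nonneg ε) (Real.sqrt_nonneg (1 - ε))
    (Real.sqrt_nonneg (1 - ε + μ)) (Real.sqrt_nonneg (ε - μ))
    (by rw [Real.sq_sqrt (by linarith), Real.sq_sqrt (by linarith)]; ring)
    (by rw [Real.sq_sqrt q0, Real.sq_sqrt (by linarith)]; ring)
    (by rw [Real.sq_sqrt (by linarith), Real.sq_sqrt (by linarith)]; ring) hd
  rw [div_le_iff₀ (binaryFidelity_pos hμ hμε hε.le), binaryFidelity_eq hμ.le hμε hε.le,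
    ← Real.sq_sqrt q0, ← mul_pow]
  refine pow_le_pow_left₀ hμ.le ?_ 2
  calc μ = _ := (sqrt_rotation_mul hμ.le hμε hε.le).symm
    _ ≤ _ := by gcongr

end Fidelity

/-! ### The extended logarithm. -/

section Logarithm

lemma log2_ofReal {x : ℝ} (hx : 0 < x) : log2 (ENNReal.ofReal x) = (Real.logb 2 x : ℝ) := by
  rw [log2, if_neg (by simpa using hx), if_neg ENNReal.ofReal_ne_top, ENNReal.toReal_ofReal hx.le]

lemma log2_mono {x y : ℝ≥0∞} (h : x ≤ y) : log2 x ≤ log2 y := by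
  unfold log2
  by_cases hx : x = 0
  · simp [hx]
  by_cases hy : y = ⊤
  · simp [hy]
  have hx' : x ≠ ⊤ := ne_top_of_le_ne_top hy h
  have hy0 : y ≠ 0 := fun h0 => hx (le_antisymm (h0 ▸ h) bot_le)
  rw [if_neg hx, if_neg hx', if_neg hy0, if_neg hy]
  have : Real.logb 2 x.toReal ≤ Real.logb 2 y.toReal :=
    Real.logb_le_logb_of_le (by norm_num) (ENNReal.toReal_pos hx hx') (ENNReal.toReal_mono hy h)
  exact_mod_cast this

lemma log2_inv (x : ℝ≥0∞) : log2 x⁻¹ = - log2 x := by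
  unfold log2
  by_cases hx : x = 0
  · simp [hx]
  by_cases hx' : x = ⊤
  · simp [hx']
  simp [hx, hx', Real.logb_inv]

lemma log2_mul_ofReal (x : ℝ≥0∞) {c : ℝ} (hc : 0 < c) :
    log2 (x * ENNReal.ofReal c) = log2 x + (Real.logb 2 c : ℝ) := by
  have hc0 : ENNReal.ofReal c ≠ 0 := by simpa using hc
  unfold log2
  by_cases hx : x = 0
  · simp [hx]
  by_cases hx' : x = ⊤
  · simp [hx', ENNReal.top_mul hc0]
  have h1 : x * ENNReal.ofReal c ≠ 0 := mul_ne_zero hx hc0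
  have h2 : x * ENNReal.ofReal c ≠ ⊤ := ENNReal.mul_ne_top hx' ENNReal.ofReal_ne_top
  rw [if_neg h1, if_neg h2, if_neg hx, if_neg hx', ENNReal.toReal_mul, ENNReal.toReal_ofReal hc.le,
    Real.logb_mul (ENNReal.toReal_pos hx hx').ne' hc.ne', EReal.coe_add]

end Logarithm

/-! ### Reduction of both entropy inequalities to operator statements. -/

section Entropies

variable {n : Type*} [Fintype n] [DecidableEq n]

lemma DH_le_infDmax_add {ε κ : ℝ} (hκ : 0 < κ) {ρ σ : Matrix n n ℂ} (hρ : IsState ρ)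
    {B : Set (Matrix n n ℂ)}
    (h : ∀ τ ∈ B, ∀ M : Matrix n n ℂ, 0 ≤ M → M ≤ 1 → ε ≤ (M * ρ).trace.re →
      κ ≤ (M * τ).trace.re) :
    DH (1 - ε) ρ σ ≤ infDmax B σ + (Real.logb 2 (1 / κ) : ℝ) := by
  refine (EReal.sub_le_iff_le_add (Or.inl (EReal.coe_ne_bot _)) (Or.inl (EReal.coe_ne_top _))).1 ?_
  refine le_iInf₂ fun τ hτ => ?_
  refine (EReal.sub_le_iff_le_add (Or.inl (EReal.coe_ne_bot _)) (Or.inl (EReal.coe_ne_top _))).2 ?_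
  rw [Dmax, ← log2_mul_ofReal _ (by positivity), DH, ← log2_inv]
  apply log2_mono
  have hr0 : ENNReal.ofReal (1 / κ) ≠ 0 := by simpa using hκ
  rw [← ENNReal.div_le_iff_le_mul (Or.inl hr0) (Or.inl ENNReal.ofReal_ne_top)]
  refine le_iInf₂ fun c hc => ?_
  rw [ENNReal.div_le_iff_le_mul (Or.inl hr0) (Or.inl ENNReal.ofReal_ne_top),
    ← ENNReal.inv_le_iff_inv_le]
  refine le_iInf₂ fun M ⟨hM0, hM1, hM⟩ => ?_
  rw [re_trace_one_sub_mul hρ] at hM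
  have h1 := h τ hτ M hM0 hM1 (by linarith)
  have h2 := re_trace_mul_mono (nonneg_iff_posSemidef.1 hM0) hc
  rw [Matrix.mul_smul, trace_smul, smul_eq_mul, Complex.re_ofReal_mul] at h2
  -- Positivity of `κ` excludes `c = 0`, so the inverse below is a genuine real one.
  have hc0 : 0 < (c : ℝ) := by
    rcases c.2.eq_or_lt with h0 | h0
    · have : (c : ℝ) = 0 := h0.symm
      rw [this] at h2
      linarith
    · exact h0
  rw [← ENNReal.ofReal_coe_nnreal, ← ENNReal.ofReal_mul hc0.le,
    ← ENNReal.ofReal_inv_of_pos (by positivity)]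
  apply ENNReal.ofReal_le_ofReal
  rw [mul_one_div, inv_div, div_le_iff₀ hc0]
  linarith

lemma infDmax_add_le_DH {ε : ℝ} (hε0 : 0 < ε) (hε : ε ≤ 1) {ρ σ : Matrix n n ℂ} (hρ : IsState ρ)
    {B : Set (Matrix n n ℂ)}
    (h : ∀ β : ℝ, 0 < β → (∀ M : Matrix n n ℂ, 0 ≤ M → M ≤ 1 → ε ≤ (M * ρ).trace.re →
      β ≤ (M * σ).trace.re) → ∃ τ ∈ B, τ ≤ ((ε / β : ℝ) : ℂ) • σ) :
    infDmax B σ + (Real.logb 2 (1 / ε) : ℝ) ≤ DH (1 - ε) ρ σ := by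
  rw [DH]
  set b := ⨅ (M : Matrix n n ℂ) (_ : 0 ≤ M ∧ M ≤ 1 ∧ ((1 - M) * ρ).trace.re ≤ 1 - ε),
      ENNReal.ofReal (M * σ).trace.re with hb
  -- If the optimal error vanishes, the right side is `⊤`. Otherwise it is finite because `M = 1` is
  -- feasible, and its real value serves as `β`.
  by_cases hb0 : b = 0
  · simp [hb0, log2]
  have hbt : b ≠ ⊤ := by
    refine ne_top_of_le_ne_top ?_ (iInf₂_le (1 : Matrix n n ℂ) ⟨zero_le_one, le_rfl, ?_⟩)
    · exact ENNReal.ofReal_ne_top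
    · simpa using hε
  have hβ := ENNReal.toReal_pos hb0 hbt
  obtain ⟨τ, hτB, hτ⟩ := h b.toReal hβ fun M hM0 hM1 hM => by
    have h1 : b ≤ ENNReal.ofReal (M * σ).trace.re := iInf₂_le M ⟨hM0, hM1, by
      rw [re_trace_one_sub_mul hρ]; linarith⟩
    have h2 : 0 < (M * σ).trace.re := by
      by_contra h3
      rw [ENNReal.ofReal_of_nonpos (not_lt.1 h3)] at h1
      exact hb0 (le_antisymm h1 bot_le)
    exact ENNReal.toReal_le_of_le_ofReal h2.le h1
  have h1 : infDmax B σ ≤ log2 (ENNReal.ofReal (ε / b.toReal)) := by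
    refine (iInf₂_le τ hτB).trans (log2_mono ?_)
    exact iInf₂_le (ε / b.toReal).toNNReal (by
      rwa [Real.coe_toNNReal _ (by positivity)])
  calc _ ≤ log2 (ENNReal.ofReal (ε / b.toReal)) + (Real.logb 2 (1 / ε) : ℝ) := by gcongr
    _ = _ := by
      rw [← log2_mul_ofReal _ (by positivity), ← ENNReal.ofReal_mul (by positivity), ← log2_inv]
      congr 1
      rw [show ε / b.toReal * (1 / ε) = b.toReal⁻¹ by field_simp, ENNReal.ofReal_inv_of_pos hβ,
        ENNReal.ofReal_toReal hbt]

end Entropies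

/-! ### Smoothing of probability distributions. -/

section Classical

/-- The classical smoothing step: a reweighting of `p` that is dominated by `(ε / β) q` and has
fidelity at least `1 - ε` with `p`. -/
lemma exists_classical_smoothing {ι : Type*} [Fintype ι] {p q : ι → ℝ} {ε β : ℝ}
    (hp : ∀ i, 0 ≤ p i) (hq : ∀ i, 0 ≤ q i) (hp1 : ∑ i, p i = 1) (hε0 : 0 < ε) (hε : ε < 1)
    (hβ : 0 < β)
    (h : ∀ t : ι → ℝ, (∀ i, 0 ≤ t i) → (∀ i, t i ≤ 1) → ε ≤ ∑ i, t i * p i →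
      β ≤ ∑ i, t i * q i) :
    ∃ g : ι → ℝ, (∀ i, 0 ≤ g i) ∧ ∑ i, g i ^ 2 * p i = 1 ∧
      (∀ i, g i ^ 2 * p i ≤ ε / β * q i) ∧ √(1 - ε) ≤ ∑ i, g i * p i := by
  classical
  have hε' : 0 < 1 - ε := by linarith
  set c := 1 / (1 - ε) with hc
  have hc1 : 1 ≤ c := by rw [hc, le_div_iff₀ hε']; linarith
  set l := ε / β with hl
  have hl0 : 0 < l := div_pos hε0 hβ
  -- The cap `c = 1 / (1 - ε)` will control the fidelity and the cap `l q` the domination.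
  -- Normalising by `S` preserves both caps once `S ≥ 1`.
  set S := ∑ i, min (c * p i) (l * q i) with hS
  have hr0 : ∀ i, 0 ≤ min (c * p i) (l * q i) := fun i =>
    le_min (mul_nonneg (by linarith) (hp i)) (mul_nonneg hl0.le (hq i))
  have hS1 : 1 ≤ S := by
    let A : Finset ι := {i | l * q i < c * p i}
    have hsplit : S = l * ∑ i ∈ A, q i + c * (1 - ∑ i ∈ A, p i) := by
      have h1 : 1 - ∑ i ∈ A, p i = ∑ i ∈ Aᶜ, p i := by
        rw [← hp1, ← Finset.sum_add_sum_compl A]; ring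
      rw [h1, hS, ← Finset.sum_add_sum_compl A, Finset.mul_sum, Finset.mul_sum]
      congr 1
      · refine Finset.sum_congr rfl fun i hi => min_eq_right ?_
        exact (Finset.mem_filter.1 hi).2.le
      · refine Finset.sum_congr rfl fun i hi => min_eq_left ?_
        simpa [A] using hi
    set a := ∑ i ∈ A, p i with ha
    have ha1 : a ≤ 1 := hp1 ▸ Finset.sum_le_univ_sum_of_nonneg hp
    rcases le_total ε a with hεa | hεa
    · have ha0 : 0 < a := by linarith
      -- The likelihood-ratio test on `A`, scaled to acceptance exactly `ε`, yields `l q(A) ≥ a`,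
      -- hence `S ≥ a + c(1 - a) ≥ 1`.
      have h1 := h (fun i => if i ∈ A then ε / a else 0)
        (fun i => by split_ifs <;> positivity)
        (fun i => by split_ifs; exacts [(div_le_one ha0).2 hεa, zero_le_one])
        (by
          simp only [ite_mul, zero_mul, Finset.sum_ite_mem, Finset.univ_inter, ← Finset.mul_sum]
          rw [← ha]; field_simp; exact le_rfl)
      simp only [ite_mul, zero_mul, Finset.sum_ite_mem, Finset.univ_inter, ← Finset.mul_sum] at h1
      have h2 : a ≤ l * ∑ i ∈ A, q i := by
        rw [hl, div_mul_eq_mul_div, le_div_iff₀ hβ]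
        rw [div_mul_eq_mul_div, le_div_iff₀ ha0] at h1
        linarith
      have h3 : 1 - a ≤ c * (1 - a) := le_mul_of_one_le_left (by linarith) hc1
      linarith
    · have h1 : 0 ≤ l * ∑ i ∈ A, q i := mul_nonneg hl0.le (Finset.sum_nonneg fun i _ => hq i)
      have h2 : c * (1 - ε) = 1 := by rw [hc]; field_simp
      have h3 : c * (1 - ε) ≤ c * (1 - a) := by gcongr
      linarith
  have hS0 : 0 < S := by linarith
  set s : ι → ℝ := fun i => min c (l * q i / p i) / S with hs
  have hs0 : ∀ i, 0 ≤ s i := fun i =>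
    div_nonneg (le_min (by linarith) (div_nonneg (mul_nonneg hl0.le (hq i)) (hp i))) hS0.le
  have hsp : ∀ i, s i * p i = min (c * p i) (l * q i) / S := by
    intro i
    rcases (hp i).eq_or_lt with h0 | h0
    · rw [← h0, mul_zero, mul_zero, min_eq_left (mul_nonneg hl0.le (hq i)), zero_div]
    · simp only [hs]
      rw [div_mul_eq_mul_div, min_mul_of_nonneg _ _ h0.le, div_mul_cancel₀ _ h0.ne']
  have hg2 : ∀ i, √(s i) ^ 2 = s i := fun i => Real.sq_sqrt (hs0 i)
  refine ⟨fun i => √(s i), fun i => Real.sqrt_nonneg _, ?_, ?_, ?_⟩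
  · simp only [hg2, hsp, ← Finset.sum_div]
    exact div_self hS0.ne'
  · intro i
    simp only [hg2, hsp]
    exact (div_le_self (hr0 i) hS1).trans (min_le_right _ _)
  -- From `s i ≤ c` follows `√(1 - ε) * s i ≤ √(s i)`; summing against `p` gives the fidelity bound.
  · have h1 : ∀ i, √(1 - ε) * (s i * p i) ≤ √(s i) * p i := by
      intro i
      rw [← mul_assoc]
      refine mul_le_mul_of_nonneg_right ?_ (hp i)
      have h2 : √(1 - ε) * √(s i) ≤ 1 := by
        rw [← Real.sqrt_mul hε'.le]
        refine Real.sqrt_le_one.2 ?_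
        have : s i ≤ c := (div_le_self (le_min (by linarith)
          (div_nonneg (mul_nonneg hl0.le (hq i)) (hp i))) hS1).trans (min_le_left _ _)
        calc (1 - ε) * s i ≤ (1 - ε) * c := by gcongr
          _ = 1 := by rw [hc]; field_simp
      calc √(1 - ε) * s i = √(1 - ε) * √(s i) * √(s i) := by
            rw [mul_assoc, Real.mul_self_sqrt (hs0 i)]
        _ ≤ 1 * √(s i) := by gcongr
        _ = √(s i) := one_mul _
    calc √(1 - ε) = √(1 - ε) * ∑ i, s i * p i := by
          simp only [hsp, ← Finset.sum_div]
          rw [div_self hS0.ne', mul_one]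
      _ ≤ _ := by rw [Finset.mul_sum]; exact Finset.sum_le_sum fun i _ => h1 i

end Classical

/-! ### Separation argument for the general lower bound. -/

section Minimax

variable {n : Type*} [Fintype n] [DecidableEq n]

/-- The states whose root fidelity with `ρ` is certified to be at least `√a` by a block matrix. -/
def certifiedBall (a : ℝ) (ρ : Matrix n n ℂ) : Set (Matrix n n ℂ) :=
  {τ | τ.trace = 1 ∧ ∃ Z : Matrix n n ℂ, (fromBlocks ρ Z Zᴴ τ).PosSemidef ∧ √a ≤ Z.trace.re}

lemma posSemidef_of_fromBlocks {ρ τ Z : Matrix n n ℂ} (h : (fromBlocks ρ Z Zᴴ τ).PosSemidef) :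
    τ.PosSemidef := by
  have := h.submatrix (Sum.inr : n → n ⊕ n)
  exact this

lemma posSemidef_real_smul {A : Matrix n n ℂ} (hA : A.PosSemidef) {a : ℝ} (ha : 0 ≤ a) :
    (a • A).PosSemidef := by
  rw [← Complex.coe_smul]
  exact hA.smul (by exact_mod_cast ha)

lemma certifiedBall_subset_ballP {ε : ℝ} (h0 : 0 ≤ ε) (h1 : ε ≤ 1) (ρ : Matrix n n ℂ) :
    certifiedBall (1 - ε) ρ ⊆ ballP (√ε) ρ := by
  rintro τ ⟨hτ, Z, hZ, hZt⟩
  refine ⟨⟨posSemidef_of_fromBlocks hZ, hτ⟩, ?_⟩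
  rw [purifiedDist_le_sqrt_iff h0]
  exact le_fidelity_of_fromBlocks (by linarith) hZ hZt

/-- Positivity of the block matrix is convex jointly in `Z` and `τ`, so certificates can be
averaged; concavity of the root fidelity is never invoked. -/
lemma convex_certifiedBall (a : ℝ) (ρ : Matrix n n ℂ) : Convex ℝ (certifiedBall a ρ) := by
  rintro τ ⟨h1, Z, h2, h3⟩ τ' ⟨h1', Z', h2', h3'⟩ s t hs ht hst
  refine ⟨?_, s • Z + t • Z', ?_, ?_⟩
  · rw [trace_add, trace_smul, trace_smul, h1, h1', ← add_smul, hst, one_smul]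
  · refine posSemidef_of_eq ((posSemidef_real_smul h2 hs).add (posSemidef_real_smul h2' ht)) ?_
    rw [fromBlocks_smul, fromBlocks_smul, fromBlocks_add, ← add_smul, hst, one_smul]
    simp
  · rw [trace_add, trace_smul, trace_smul, Complex.add_re, Complex.smul_re, Complex.smul_re,
      smul_eq_mul, smul_eq_mul]
    calc √a = s * √a + t * √a := by rw [← add_mul, hst, one_mul]
      _ ≤ _ := by gcongr

lemma norm_sq_le_conjTranspose_mul_self {m : Type*} [Fintype m] (C : Matrix m m ℂ) (i j : m) :
    ‖C i j‖ ^ 2 ≤ ((Cᴴ * C) j j).re := by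
  have : ((Cᴴ * C) j j).re = ∑ k, ‖C k j‖ ^ 2 := by
    rw [mul_apply, Complex.re_sum]
    refine Finset.sum_congr rfl fun k _ => ?_
    rw [conjTranspose_apply, Complex.star_def, Complex.conj_mul', ← Complex.ofReal_pow,
      Complex.ofReal_re]
  rw [this]
  exact Finset.single_le_sum (f := fun k => ‖C k j‖ ^ 2) (fun k _ => sq_nonneg _)
    (Finset.mem_univ i)

lemma IsSubstate.diag_re_le_one {ρ : Matrix n n ℂ} (hρ : IsSubstate ρ) (i : n) :
    (ρ i i).re ≤ 1 := by
  refine le_trans ?_ hρ.trace_le_one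
  rw [trace, Complex.re_sum]
  exact Finset.single_le_sum (f := fun k => (ρ k k).re)
    (fun k _ => (Complex.le_def.1 hρ.posSemidef.diag_nonneg).1) (Finset.mem_univ i)

/-- Writing the block matrix as `CᴴC` exhibits the ball as the continuous image of a closed set of
matrices `C`. The columns of `C` have norm at most one, since their squared norms are diagonal
entries of states. -/
lemma isCompact_certifiedBall (a : ℝ) {ρ : Matrix n n ℂ} (hρ : IsState ρ) :
    IsCompact (certifiedBall a ρ) := by
  let Q : Matrix (n ⊕ n) (n ⊕ n) ℂ → Matrix (n ⊕ n) (n ⊕ n) ℂ := fun C => Cᴴ * C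
  have hQ : Continuous Q := continuous_id.matrix_conjTranspose.matrix_mul continuous_id
  let K : Set (Matrix (n ⊕ n) (n ⊕ n) ℂ) :=
    {C | (Q C).submatrix Sum.inl Sum.inl = ρ ∧ ((Q C).submatrix Sum.inr Sum.inr).trace = 1 ∧
      √a ≤ ((Q C).submatrix Sum.inl Sum.inr).trace.re}
  have hK : IsCompact K := by
    have hbox : IsCompact (Set.univ.pi fun _ : n ⊕ n => Set.univ.pi fun _ : n ⊕ n =>
        Metric.closedBall (0 : ℂ) 1) :=
      isCompact_univ_pi fun _ => isCompact_univ_pi fun _ => isCompact_closedBall 0 1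
    refine IsCompact.of_isClosed_subset hbox ?_ ?_
    · refine IsClosed.inter ?_ (IsClosed.inter ?_ ?_)
      · exact isClosed_eq (hQ.matrix_submatrix _ _) continuous_const
      · exact isClosed_eq (hQ.matrix_submatrix _ _).matrix_trace continuous_const
      · exact isClosed_le continuous_const
          (Complex.continuous_re.comp (hQ.matrix_submatrix _ _).matrix_trace)
    · rintro C ⟨h1, h2, -⟩ i - j -
      rw [mem_closedBall_zero_iff]
      have h3 := norm_sq_le_conjTranspose_mul_self C i j
      have h4 : ((Cᴴ * C) j j).re ≤ 1 := by
        rcases j with j | j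
        · rw [show (Cᴴ * C) (Sum.inl j) (Sum.inl j) = ρ j j from congrFun (congrFun h1 j) j]
          exact hρ.isSubstate.diag_re_le_one j
        · have h5 : IsState ((Q C).submatrix (Sum.inr : n → n ⊕ n) Sum.inr) :=
            ⟨(posSemidef_conjTranspose_mul_self C).submatrix _, h2⟩
          exact h5.isSubstate.diag_re_le_one j
      nlinarith [norm_nonneg (C i j)]
  have himg : certifiedBall a ρ = (fun C => (Q C).submatrix Sum.inr Sum.inr) '' K := by
    ext τ
    constructor
    · rintro ⟨h1, Z, h2, h3⟩
      have hC : Q (CFC.sqrt (fromBlocks ρ Z Zᴴ τ)) = fromBlocks ρ Z Zᴴ τ := by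
        simp only [Q]
        rw [conjTranspose_sqrt]; exact sqrt_mul_sqrt h2
      refine ⟨CFC.sqrt (fromBlocks ρ Z Zᴴ τ), ⟨?_, ?_, ?_⟩, ?_⟩
      all_goals simp only [hC]
      · rfl
      · exact h1
      · exact h3
      · rfl
    · rintro ⟨C, ⟨h1, h2, h3⟩, rfl⟩
      refine ⟨h2, (Q C).submatrix Sum.inl Sum.inr, ?_, h3⟩
      refine posSemidef_of_eq (posSemidef_conjTranspose_mul_self C) ?_
      rw [← h1]
      have hQh : (Cᴴ * C)ᴴ = Cᴴ * C := isHermitian_conjTranspose_mul_self C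
      ext (i | i) (j | j)
      · rfl
      · rfl
      · exact congrFun (congrFun hQh (Sum.inr i)) (Sum.inl j)
      · rfl
  rw [himg]
  exact hK.image (hQ.matrix_submatrix _ _)

lemma convex_setOf_le (L : Matrix n n ℂ) : Convex ℝ {X : Matrix n n ℂ | X ≤ L} := by
  intro X hX Y hY s t hs ht hst
  refine posSemidef_of_eq ((posSemidef_real_smul hX hs).add (posSemidef_real_smul hY ht)) ?_
  rw [smul_sub, smul_sub]
  have : L = s • L + t • L := by rw [← add_smul, hst, one_smul]
  nth_rw 1 [this]
  abel

lemma isClosed_setOf_le (L : Matrix n n ℂ) : IsClosed {X : Matrix n n ℂ | X ≤ L} := by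
  have : {X : Matrix n n ℂ | X ≤ L} = {X | (L - X)ᴴ = L - X} ∩
      ⋂ x : n → ℂ, {X | 0 ≤ star x ⬝ᵥ ((L - X) *ᵥ x)} := by
    ext X
    simp only [Set.mem_ofPred_eq, le_iff, Set.mem_inter_iff, Set.mem_iInter]
    exact posSemidef_iff_dotProduct_mulVec
  rw [this]
  have hc : Continuous fun X : Matrix n n ℂ => L - X := continuous_const.sub continuous_id
  refine IsClosed.inter (isClosed_eq hc.matrix_conjTranspose hc) (isClosed_iInter fun x => ?_)
  exact isClosed_le continuous_const
    (continuous_const.dotProduct (hc.matrix_mulVec continuous_const))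

/-- Real linear functionals on Hermitian matrices are represented by Hermitian matrices. -/
lemma exists_hermitian_representation (f : Matrix n n ℂ →ₗ[ℝ] ℝ) :
    ∃ H : Matrix n n ℂ, H.IsHermitian ∧ ∀ X : Matrix n n ℂ, X.IsHermitian →
      f X = (H * X).trace.re := by
  let N : Matrix n n ℂ := of fun j i =>
    (f (single i j 1) : ℂ) - Complex.I * (f (single i j Complex.I) : ℂ)
  have hN : ∀ X : Matrix n n ℂ, f X = (N * X).trace.re := by
    intro X
    have hX : X = ∑ i, ∑ j, ((X i j).re • single i j (1 : ℂ) + (X i j).im • single i j Complex.I) := by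
      conv_lhs => rw [matrix_eq_sum_single X]
      refine Finset.sum_congr rfl fun i _ => Finset.sum_congr rfl fun j _ => ?_
      rw [smul_single, smul_single, ← single_add]
      congr 1
      simp
    conv_lhs => rw [hX]
    simp only [map_sum, map_add, map_smul, smul_eq_mul, trace, diag, mul_apply, Complex.re_sum]
    rw [Finset.sum_comm]
    refine Finset.sum_congr rfl fun j _ => Finset.sum_congr rfl fun i _ => ?_
    simp [N]
    ring
  refine ⟨(1 / 2 : ℝ) • (N + Nᴴ), ?_, ?_⟩
  · rw [IsHermitian, conjTranspose_smul, conjTranspose_add, conjTranspose_conjTranspose, add_comm]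
    simp
  · intro X hX
    have h1 : (Nᴴ * X).trace.re = (N * X).trace.re := by
      rw [← trace_conjTranspose_re, conjTranspose_mul, conjTranspose_conjTranspose, hX.eq,
        trace_mul_comm]
    rw [hN, smul_mul, trace_smul, add_mul, trace_add, Complex.smul_re, Complex.add_re, h1,
      smul_eq_mul]
    ring

/-- Self-duality of the positive cone, tested on rank-one matrices. -/
lemma posSemidef_of_re_trace_nonneg {H : Matrix n n ℂ} (hH : H.IsHermitian)
    (h : ∀ X : Matrix n n ℂ, X.PosSemidef → 0 ≤ (H * X).trace.re) : H.PosSemidef := by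
  refine PosSemidef.of_dotProduct_mulVec_nonneg hH fun x => ?_
  have h1 := h _ (posSemidef_vecMulVec_self_star x)
  rw [mul_vecMulVec, trace_vecMulVec, dotProduct_comm] at h1
  rw [Complex.le_def]
  exact ⟨h1, (hH.im_star_dotProduct_mulVec_self x).symm⟩

/-- The pointwise bound behind the minimax argument. -/
lemma exists_mem_certifiedBall_trace_le {ρ σ M : Matrix n n ℂ} {ε β : ℝ} (hε0 : 0 < ε)
    (hε : ε < 1) (hβ : 0 < β) (hρ : IsState ρ) (hσ : IsState σ) (hM : M.PosSemidef)
    (h : ∀ N : Matrix n n ℂ, 0 ≤ N → N ≤ 1 → ε ≤ (N * ρ).trace.re → β ≤ (N * σ).trace.re) :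
    ∃ τ ∈ certifiedBall (1 - ε) ρ, (M * τ).trace.re ≤ ε / β * (M * σ).trace.re := by
  set V : Matrix n n ℂ := hM.isHermitian.eigenvectorUnitary.1 with hV
  have hV1 : V * Vᴴ = 1 := Unitary.mul_star_self_of_mem hM.isHermitian.eigenvectorUnitary.2
  have hV2 : Vᴴ * V = 1 := Unitary.star_mul_self_of_mem hM.isHermitian.eigenvectorUnitary.2
  let D : (n → ℝ) → Matrix n n ℂ := fun d => V * diagonal (fun i => (d i : ℂ)) * Vᴴ
  set w := hM.isHermitian.eigenvalues
  have hw : ∀ i, 0 ≤ w i := hM.eigenvalues_nonneg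
  have hMD : M = D w := hM.isHermitian.spectral_theorem
  have hDmul : ∀ d e : n → ℝ, D d * D e = D (fun i => d i * e i) := by
    intro d e
    calc D d * D e = V * diagonal (fun i => (d i : ℂ)) * (Vᴴ * V) *
          diagonal (fun i => (e i : ℂ)) * Vᴴ := by simp only [D, mul_assoc]
      _ = _ := by
        rw [hV2, mul_one, mul_assoc V, diagonal_mul_diagonal]
        simp only [D, Complex.ofReal_mul]
  have hDtr : ∀ (d : n → ℝ) (X : Matrix n n ℂ),
      (D d * X).trace.re = ∑ i, d i * ((Vᴴ * X * V) i i).re := by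
    intro d X
    have : (D d * X).trace = (diagonal (fun i => (d i : ℂ)) * (Vᴴ * X * V)).trace := by
      simp only [D]
      rw [mul_assoc, mul_assoc, trace_mul_comm]
      simp only [mul_assoc]
    rw [this, trace, Complex.re_sum]
    refine Finset.sum_congr rfl fun i _ => ?_
    rw [diag_apply, diagonal_mul, Complex.re_ofReal_mul]
  have hDpos : ∀ d : n → ℝ, (∀ i, 0 ≤ d i) → (D d).PosSemidef := by
    intro d hd
    refine PosSemidef.mul_mul_conjTranspose_same (PosSemidef.diagonal fun i => ?_) V
    exact Complex.zero_le_real.2 (hd i)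
  have hD1 : D (fun _ => 1) = 1 := by simp [D, hV1]
  have hDsub : ∀ d e : n → ℝ, D d - D e = D (fun i => d i - e i) := by
    intro d e
    simp only [D, ← sub_mul, ← mul_sub, diagonal_sub, Complex.ofReal_sub]
  have hDh : ∀ d : n → ℝ, (D d)ᴴ = D d := by
    intro d
    simp only [D, conjTranspose_mul, conjTranspose_conjTranspose, diagonal_conjTranspose, mul_assoc]
    have : star (fun i => (d i : ℂ)) = fun i => (d i : ℂ) := funext fun i => Complex.conj_ofReal _
    rw [this]
  set p : n → ℝ := fun i => ((Vᴴ * ρ * V) i i).re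
  set q : n → ℝ := fun i => ((Vᴴ * σ * V) i i).re
  have hp : ∀ i, 0 ≤ p i := fun i =>
    (Complex.le_def.1 (hρ.posSemidef.conjTranspose_mul_mul_same V).diag_nonneg).1
  have hq : ∀ i, 0 ≤ q i := fun i =>
    (Complex.le_def.1 (hσ.posSemidef.conjTranspose_mul_mul_same V).diag_nonneg).1
  have hp1 : ∑ i, p i = 1 := by
    have := hDtr (fun _ => 1) ρ
    simp only [hD1, one_mul, hρ.trace_eq_one, Complex.one_re] at this
    exact this.symm
  -- The distributions are the diagonals of `ρ` and `σ` in the eigenbasis of `M`; a classical test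
  -- lifts to an operator test diagonal in that basis.
  obtain ⟨g, hg0, hg1, hgq, hgF⟩ := exists_classical_smoothing hp hq hp1 hε0 hε hβ
    fun t ht0 ht1 ht => by
      rw [← hDtr t σ]
      refine h (D t) (nonneg_iff_posSemidef.2 (hDpos t ht0)) ?_ (by rwa [hDtr])
      rw [le_iff, ← hD1, hDsub]
      exact hDpos _ fun i => sub_nonneg.2 (ht1 i)
  set G := D g
  have hGh : Gᴴ = G := hDh g
  have hcyc : ∀ d : n → ℝ, (D d * (G * ρ * G)).trace.re = ∑ i, d i * (g i ^ 2 * p i) := by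
    intro d
    have e : (D d * (G * ρ * G)).trace = (D (fun i => g i * d i * g i) * ρ).trace := by
      rw [← hDmul, ← hDmul, ← mul_assoc, trace_mul_comm]
      simp only [G, mul_assoc]
    rw [e, hDtr]
    exact Finset.sum_congr rfl fun i _ => by ring
  have hpos : (G * ρ * G).PosSemidef := by
    have := hρ.posSemidef.conjTranspose_mul_mul_same G
    rwa [hGh] at this
  -- The reweighting is applied to the full `ρ`, not to its diagonal. The certificate is the block
  -- column `(1, G)` conjugating `ρ`, and `Tr ρG` is the classical overlap.
  refine ⟨G * ρ * G, ⟨?_, ρ * G, ?_, ?_⟩, ?_⟩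
  · have h1 := hcyc fun _ => 1
    simp only [hD1, one_mul, hg1] at h1
    refine Complex.ext h1 ?_
    have := (Complex.le_def.1 hpos.trace_nonneg).2
    simpa using this.symm
  · have h1 := hρ.posSemidef.mul_mul_conjTranspose_same (fromRows 1 G : Matrix (n ⊕ n) n ℂ)
    refine posSemidef_of_eq h1 ?_
    have hρh : ρᴴ = ρ := hρ.posSemidef.isHermitian
    rw [conjTranspose_fromRows_eq_fromCols_conjTranspose, fromRows_mul, fromRows_mul_fromCols,
      conjTranspose_mul, hGh, hρh]
    simp
  · have h1 := hDtr g ρ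
    rw [trace_mul_comm, h1]
    exact hgF
  · nth_rw 1 [hMD]
    rw [hcyc]
    conv_rhs => rw [hMD, hDtr, Finset.mul_sum]
    refine Finset.sum_le_sum fun i _ => ?_
    have := mul_le_mul_of_nonneg_left (hgq i) (hw i)
    calc _ ≤ _ := this
      _ = _ := by ring

instance instLocallyConvexSpaceMatrix : LocallyConvexSpace ℝ (Matrix n n ℂ) :=
  inferInstanceAs (LocallyConvexSpace ℝ (n → n → ℂ))

lemma exists_mem_certifiedBall_le {ρ σ : Matrix n n ℂ} {ε β : ℝ} (hε0 : 0 < ε)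
    (hε : ε < 1) (hβ : 0 < β) (hρ : IsState ρ) (hσ : IsState σ)
    (h : ∀ N : Matrix n n ℂ, 0 ≤ N → N ≤ 1 → ε ≤ (N * ρ).trace.re → β ≤ (N * σ).trace.re) :
    ∃ τ ∈ certifiedBall (1 - ε) ρ, τ ≤ ((ε / β : ℝ) : ℂ) • σ := by
  by_contra! hcon
  set L := ((ε / β : ℝ) : ℂ) • σ with hL
  have hLp : L.PosSemidef := hσ.posSemidef.smul (by exact_mod_cast (div_pos hε0 hβ).le)
  obtain ⟨f, u, v, hu, huv, hv⟩ := geometric_hahn_banach_compact_closed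
    (convex_certifiedBall (1 - ε) ρ) (isCompact_certifiedBall (1 - ε) hρ)
    (convex_setOf_le L) (isClosed_setOf_le L)
    (Set.disjoint_left.2 fun τ h1 h2 => hcon τ h1 h2)
  obtain ⟨H, hH, hfH⟩ := exists_hermitian_representation (-f.toLinearMap)
  have hf : ∀ X : Matrix n n ℂ, X.IsHermitian → f X = -(H * X).trace.re := by
    intro X hX
    rw [← hfH X hX]; simp
  -- The set below `L` contains `L - kX` for every positive `X`, so a functional bounded below on it
  -- must be nonpositive on `X`.
  have hHp : H.PosSemidef := by
    refine posSemidef_of_re_trace_nonneg hH fun X hX => ?_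
    by_contra! hneg
    have hfX : 0 < f X := by rw [hf X hX.isHermitian]; linarith
    obtain ⟨k, hk⟩ := exists_nat_gt ((f L - v) / f X)
    rw [div_lt_iff₀ hfX] at hk
    have h1 := hv (L - (k : ℝ) • X) (by
      have := posSemidef_real_smul hX (Nat.cast_nonneg (α := ℝ) k)
      refine posSemidef_of_eq this ?_
      abel)
    have h2 : f ((k : ℝ) • X) = k * f X := by rw [map_smul, smul_eq_mul]
    rw [map_sub, h2] at h1
    linarith
  obtain ⟨τ, hτ, hτle⟩ := exists_mem_certifiedBall_trace_le hε0 hε hβ hρ hσ hHp h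
  have h1 := hu τ hτ
  have h2 := hv L (le_refl L)
  have hτp : τ.IsHermitian := by
    obtain ⟨-, Z, hZ, -⟩ := hτ
    exact (posSemidef_of_fromBlocks hZ).isHermitian
  rw [hf τ hτp] at h1
  rw [hf L hLp.isHermitian, hL, Matrix.mul_smul, trace_smul, smul_eq_mul,
    Complex.re_ofReal_mul] at h2
  linarith

end Minimax

/-! ### The commuting case. -/

section Commuting

variable {n : Type*} [Fintype n] [DecidableEq n]

/-- The projection onto the positive part of a Hermitian matrix. -/
lemma exists_positive_projection {H : Matrix n n ℂ} (hH : H.IsHermitian) :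
    ∃ P : Matrix n n ℂ, Pᴴ = P ∧ P * P = P ∧ 0 ≤ P * H ∧ 0 ≤ (P - 1) * H ∧
      ∀ X : Matrix n n ℂ, Commute H X → Commute P X := by
  have hc : ∀ f : ℝ → ℝ, ContinuousOn f (spectrum ℝ H) := fun f =>
    H.finite_real_spectrum.continuousOn f
  have hHs : IsSelfAdjoint H := hH
  have hid : cfc (fun x : ℝ => x) H = H := cfc_id' ℝ H
  set f : ℝ → ℝ := fun x => if 0 < x then 1 else 0
  have hPH : cfc f H * H = cfc (fun x => f x * x) H := by rw [cfc_mul _ _ H (hc _) (hc _), hid]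
  refine ⟨cfc f H, (cfc_predicate f H : IsSelfAdjoint _), ?_, ?_, ?_, ?_⟩
  · rw [← cfc_mul _ _ H (hc _) (hc _)]
    congr 1
    funext x
    simp only [f]
    split_ifs <;> simp
  · rw [hPH]
    refine cfc_nonneg fun x _ => ?_
    simp only [f]
    split_ifs with hx
    · simpa using hx.le
    · simp
  · rw [sub_mul, one_mul, hPH]
    nth_rw 2 [← hid]
    rw [← cfc_sub _ _ H (hc _) (hc _)]
    refine cfc_nonneg fun x _ => ?_
    simp only [f]
    split_ifs with hx
    · simp
    · simpa using hx
  · intro X hX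
    exact Commute.cfc hX (by rwa [hHs.star_eq]) f

lemma exists_mem_ballT_le_of_commute {ρ σ : Matrix n n ℂ} {ε β : ℝ} (hε0 : 0 < ε)
    (hε : ε < 1) (hβ : 0 < β) (hρ : IsState ρ) (hσ : IsState σ) (hcomm : Commute ρ σ)
    (h : ∀ N : Matrix n n ℂ, 0 ≤ N → N ≤ 1 → ε ≤ (N * ρ).trace.re → β ≤ (N * σ).trace.re) :
    ∃ τ ∈ ballT ε ρ, τ ≤ ((ε / β : ℝ) : ℂ) • σ := by
  simp only [Complex.coe_smul]
  set l := ε / β with hl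
  have hl0 : 0 < l := div_pos hε0 hβ
  have hσtr : (σ.trace).re = 1 := by rw [hσ.trace_eq_one]; rfl
  have hρtr : (ρ.trace).re = 1 := by rw [hρ.trace_eq_one]; rfl
  -- The constant test `ε • 1` gives `β ≤ ε`. This leaves enough mass in `lσ` for the normalisation
  -- below.
  have hl1 : 1 ≤ l := by
    have h1 := h (ε • 1) (nonneg_iff_posSemidef.2 (posSemidef_real_smul PosSemidef.one hε0.le))
      (posSemidef_of_eq (posSemidef_real_smul PosSemidef.one (sub_nonneg.2 hε.le))
        (by rw [sub_smul, one_smul]))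
      (by rw [smul_mul, one_mul, trace_smul, Complex.smul_re, hρtr]; simp)
    rw [smul_mul, one_mul, trace_smul, Complex.smul_re, hσtr, smul_eq_mul, mul_one] at h1
    rw [hl, le_div_iff₀ hβ]; linarith
  have hlσ : (l • σ).PosSemidef := posSemidef_real_smul hσ.posSemidef hl0.le
  obtain ⟨P, hPh, hPP, hPH, hPH', hPX⟩ := exists_positive_projection
    (hρ.posSemidef.isHermitian.sub hlσ.isHermitian)
  have hcσ : Commute P σ := hPX σ (hcomm.sub_left ((Commute.refl σ).smul_left l))
  have hcρ : Commute P ρ := hPX ρ ((Commute.refl ρ).sub_left (hcomm.symm.smul_left l))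
  have hP0 : 0 ≤ P := by
    have := posSemidef_conjTranspose_mul_self P
    rw [hPh, hPP] at this
    exact nonneg_iff_posSemidef.2 this
  have hQQ : (1 - P) * (1 - P) = 1 - P := by
    rw [sub_mul, mul_sub, mul_sub, hPP]; simp
  have hQh : (1 - P)ᴴ = 1 - P := by rw [conjTranspose_sub, conjTranspose_one, hPh]
  have hP1 : P ≤ 1 := by
    have := posSemidef_conjTranspose_mul_self (1 - P)
    rw [hQh, hQQ] at this
    exact this
  -- The operator minimum of `ρ` and `lσ`; commutation makes it positive.
  set ρ₀ := (1 - P) * ρ + l • (P * σ) with hρ₀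
  have e1 : ρ - ρ₀ = P * (ρ - l • σ) := by
    rw [hρ₀, mul_sub, sub_mul, one_mul, mul_smul_comm]; abel
  have e2 : l • σ - ρ₀ = (P - 1) * (ρ - l • σ) := by
    rw [hρ₀, mul_sub, sub_mul, sub_mul, sub_mul, one_mul, mul_smul_comm, one_mul]; abel
  have hle1 : ρ₀ ≤ ρ := by
    rw [le_iff, e1]; exact nonneg_iff_posSemidef.1 hPH
  have hle2 : ρ₀ ≤ l • σ := by
    rw [le_iff, e2]; exact nonneg_iff_posSemidef.1 hPH'
  have hpos : ρ₀.PosSemidef := by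
    have a1 := hρ.posSemidef.conjTranspose_mul_mul_same (1 - P)
    have a2 := hσ.posSemidef.conjTranspose_mul_mul_same P
    have c1 : Commute (1 - P) ρ := (Commute.one_left ρ).sub_left hcρ
    rw [hQh, mul_assoc, ← c1.eq, ← mul_assoc, hQQ] at a1
    rw [hPh, mul_assoc, ← hcσ.eq, ← mul_assoc, hPP] at a2
    exact a1.add (posSemidef_real_smul a2 hl0.le)
  set S := ρ₀.trace.re with hS
  set b := (P * ρ).trace.re with hb
  set d := (P * σ).trace.re with hd
  have hd0 : 0 ≤ d := re_trace_mul_nonneg (nonneg_iff_posSemidef.1 hP0) hσ.posSemidef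
  have hSb : S = 1 - b + l * d := by
    rw [hS, hρ₀, trace_add, Complex.add_re, re_trace_one_sub_mul hρ, trace_smul, Complex.smul_re,
      smul_eq_mul]
  have hS1 : S ≤ 1 := by
    have := re_trace_mul_mono (PosSemidef.one (n := n)) hle1
    rwa [one_mul, one_mul, hρtr] at this
  -- The mass cut off is `b - l d`. If `b > ε`, the test `(ε / b) • P` shows that nothing is lost on
  -- balance.
  have hSε : 1 - ε ≤ S := by
    rcases le_total b ε with hbε | hbε
    · have := mul_nonneg hl0.le hd0
      linarith
    · have hb0 : 0 < b := by linarith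
      have hr1 : ε / b ≤ 1 := (div_le_one hb0).2 hbε
      have hPp := nonneg_iff_posSemidef.1 hP0
      have h1 := h ((ε / b) • P)
        (nonneg_iff_posSemidef.2 (posSemidef_real_smul hPp (by positivity)))
        (le_trans (posSemidef_of_eq (posSemidef_real_smul hPp (sub_nonneg.2 hr1))
          (by rw [sub_smul, one_smul])) hP1)
        (by rw [smul_mul, trace_smul, Complex.smul_re, ← hb, smul_eq_mul]; field_simp; exact le_rfl)
      rw [smul_mul, trace_smul, Complex.smul_re, ← hd, smul_eq_mul, div_mul_eq_mul_div,
        le_div_iff₀ hb0] at h1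
      have : b ≤ l * d := by
        rw [hl, div_mul_eq_mul_div, le_div_iff₀ hβ]; linarith
      linarith
  -- Moving from `ρ₀` towards `lσ` by this fraction restores trace one while staying below `lσ`. If
  -- `l = S`, both equal one and the default value `0` is correct.
  set s := (1 - S) / (l - S) with hs
  have hs0 : 0 ≤ s := div_nonneg (by linarith) (by linarith)
  have hs1 : s ≤ 1 := div_le_one_of_le₀ (by linarith) (by linarith)
  have hsS : S + s * (l - S) = 1 := by
    rcases eq_or_ne (l - S) 0 with h0 | h0
    · rw [h0]; linarith
    · rw [hs, div_mul_cancel₀ _ h0]; ring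
  set τ := ρ₀ + s • (l • σ - ρ₀) with hτ
  have hτle : τ ≤ l • σ := by
    refine posSemidef_of_eq (posSemidef_real_smul (le_iff.1 hle2) (sub_nonneg.2 hs1)) ?_
    rw [hτ, sub_smul, one_smul]; abel
  have hτge : ρ₀ ≤ τ := by
    refine posSemidef_of_eq (posSemidef_real_smul (le_iff.1 hle2) hs0) ?_
    rw [hτ]; abel
  have hτpos : τ.PosSemidef := hpos.add (posSemidef_real_smul (le_iff.1 hle2) hs0)
  have hτtr : τ.trace = 1 := by
    refine Complex.ext ?_ ?_
    · rw [hτ, trace_add, trace_smul, trace_sub, trace_smul, Complex.add_re, Complex.smul_re,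
        Complex.sub_re, Complex.smul_re, hσtr, ← hS, smul_eq_mul, smul_eq_mul, mul_one, hsS]
      rfl
    · simpa using (Complex.le_def.1 hτpos.trace_nonneg).2.symm
  refine ⟨τ, ⟨⟨hτpos, hτtr⟩, ?_⟩, hτle⟩
  obtain ⟨M, hM0, hM1, hM⟩ := exists_test_traceNorm
    (hρ.posSemidef.isHermitian.sub hτpos.isHermitian)
  have ht : (ρ - τ).trace = 0 := by rw [trace_sub, hρ.trace_eq_one, hτtr, sub_self]
  rw [ht] at hM
  simp only [Complex.zero_re, zero_div, add_zero] at hM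
  rw [traceDist, ← hM]
  calc (M * (ρ - τ)).trace.re ≤ (M * (ρ - ρ₀)).trace.re :=
        re_trace_mul_mono (nonneg_iff_posSemidef.1 hM0) (sub_le_sub_left hτge ρ)
    _ ≤ (1 * (ρ - ρ₀)).trace.re := re_trace_mul_mono' (le_iff.1 hle1) hM1
    _ = 1 - S := by rw [one_mul, trace_sub, Complex.sub_re, hρtr]
    _ ≤ ε := by linarith

end Commuting

/-! ### Exact values of the entropies and diagonal qubits. -/

section Tightness

variable {n : Type*} [Fintype n] [DecidableEq n]

/-- The choice `τ = σ` gives zero, and comparing traces in `τ ≤ cσ` forces `c ≥ 1` for normalised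
states. -/
lemma infDmax_eq_zero {B : Set (Matrix n n ℂ)} (hB : ∀ τ ∈ B, IsState τ) {σ : Matrix n n ℂ}
    (hσ : σ ∈ B) : infDmax B σ = 0 := by
  have h0 : log2 (ENNReal.ofReal 1) = 0 := by rw [log2_ofReal one_pos]; simp
  apply le_antisymm
  · refine (iInf₂_le σ hσ).trans ?_
    rw [← h0]
    exact log2_mono (iInf₂_le_of_le 1 (by simp) (by simp))
  · refine le_iInf₂ fun τ hτ => ?_
    rw [← h0]
    refine log2_mono (le_iInf₂ fun c hc => ?_)
    have h1 := re_trace_mul_mono (PosSemidef.one (n := n)) hc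
    rw [one_mul, one_mul, trace_smul, (hB σ hσ).trace_eq_one, (hB τ hτ).trace_eq_one] at h1
    simp only [smul_eq_mul, mul_one, Complex.one_re, Complex.ofReal_re] at h1
    rw [ENNReal.ofReal_one]
    exact_mod_cast h1

lemma DH_eq_logb {ε κ : ℝ} (hκ : 0 < κ) {ρ σ M : Matrix n n ℂ} (hρ : IsState ρ)
    (h : ∀ N : Matrix n n ℂ, 0 ≤ N → N ≤ 1 → ε ≤ (N * ρ).trace.re → κ ≤ (N * σ).trace.re)
    (hM0 : 0 ≤ M) (hM1 : M ≤ 1) (hMρ : ε ≤ (M * ρ).trace.re) (hMσ : (M * σ).trace.re = κ) :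
    DH (1 - ε) ρ σ = (Real.logb 2 (1 / κ) : ℝ) := by
  rw [DH, one_div, Real.logb_inv, EReal.coe_neg, ← log2_ofReal hκ]
  congr 2
  apply le_antisymm
  · rw [← hMσ]
    refine iInf₂_le M ⟨hM0, hM1, ?_⟩
    rw [re_trace_one_sub_mul hρ]; linarith
  · refine le_iInf₂ fun N ⟨hN0, hN1, hN⟩ => ENNReal.ofReal_le_ofReal (h N hN0 hN1 ?_)
    rw [re_trace_one_sub_mul hρ] at hN; linarith

lemma self_mem_ballP {ε : ℝ} (hε : 0 ≤ ε) {ρ : Matrix n n ℂ} (hρ : IsState ρ) :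
    ρ ∈ ballP ε ρ := by
  refine ⟨hρ, ?_⟩
  have h1 : (1 : ℝ) ≤ traceNorm ρ := by
    have := re_trace_mul_le_traceNorm (W := 1) (X := ρ) (by simp)
    rwa [one_mul, hρ.trace_eq_one] at this
  have h2 : 1 ≤ fidelity ρ ρ := by
    rw [fidelity, sqrt_mul_sqrt hρ.posSemidef]
    exact one_le_pow₀ h1
  rw [purifiedDist, Real.sqrt_eq_zero_of_nonpos (by linarith)]
  exact hε

lemma DH_self {ε : ℝ} (hε0 : 0 < ε) (hε : ε ≤ 1) {ρ : Matrix n n ℂ} (hρ : IsState ρ) :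
    DH (1 - ε) ρ ρ = (Real.logb 2 (1 / ε) : ℝ) := by
  have h1 : ((ε • (1 : Matrix n n ℂ)) * ρ).trace.re = ε := by
    rw [smul_mul, one_mul, trace_smul, Complex.smul_re, hρ.trace_eq_one]; simp
  exact DH_eq_logb (M := ε • 1) hε0 hρ (fun N _ _ hN => hN)
    (nonneg_iff_posSemidef.2 (posSemidef_real_smul PosSemidef.one hε0.le))
    (posSemidef_of_eq (posSemidef_real_smul PosSemidef.one (sub_nonneg.2 hε))
      (by rw [sub_smul, one_smul])) h1.ge h1

/-- The diagonal qubit state with eigenvalues `a` and `1 - a`. -/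
def qubit (a : ℝ) : Matrix (Fin 2) (Fin 2) ℂ := diagonal ![(a : ℂ), ((1 - a : ℝ) : ℂ)]

lemma isState_qubit {a : ℝ} (h0 : 0 ≤ a) (h1 : a ≤ 1) : IsState (qubit a) := by
  refine ⟨PosSemidef.diagonal fun i => ?_, by simp [qubit]⟩
  fin_cases i
  · exact Complex.zero_le_real.2 h0
  · exact Complex.zero_le_real.2 (sub_nonneg.2 h1)

lemma commute_qubit (a b : ℝ) : Commute (qubit a) (qubit b) := by
  rw [Commute, SemiconjBy, qubit, qubit, diagonal_mul_diagonal, diagonal_mul_diagonal]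
  simp only [mul_comm]

lemma re_trace_qubit_mul (a : ℝ) : (qubit 1 * qubit a).trace.re = a := by
  simp [qubit]

lemma qubit_mem_ballT {a b : ℝ} (hb0 : 0 ≤ b) (hba : b ≤ a) (ha1 : a ≤ 1) :
    qubit b ∈ ballT (a - b) (qubit a) := by
  have ha := isState_qubit (hb0.trans hba) ha1
  have hb := isState_qubit hb0 (hba.trans ha1)
  refine ⟨hb, ?_⟩
  obtain ⟨M, hM0, hM1, hM⟩ := exists_test_traceNorm
    (ha.posSemidef.isHermitian.sub hb.posSemidef.isHermitian)
  have ht : (qubit a - qubit b).trace = 0 := by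
    rw [trace_sub, ha.trace_eq_one, hb.trace_eq_one, sub_self]
  rw [ht] at hM
  simp only [Complex.zero_re, zero_div, add_zero] at hM
  rw [traceDist, ← hM]
  have h0 : (M 0 0).re ≤ 1 := by
    have := (Complex.le_def.1 ((le_iff.1 hM1).diag_nonneg (i := (0 : Fin 2)))).1
    simpa using this
  have h1 : 0 ≤ (M 1 1).re :=
    (Complex.le_def.1 ((nonneg_iff_posSemidef.1 hM0).diag_nonneg (i := (1 : Fin 2)))).1
  have h2 : (M * (qubit a - qubit b)).trace.re = (a - b) * ((M 0 0).re - (M 1 1).re) := by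
    rw [qubit, qubit, diagonal_sub, trace_fin_two, mul_diagonal, mul_diagonal]
    simp
    ring
  rw [h2]
  exact mul_le_of_le_one_right (by linarith) (by linarith)

/-- The roots are supplied as data of arbitrary sign, and a diagonal block certificate replaces any
computation of matrix square roots. -/
lemma le_fidelity_qubit {a b r t u v : ℝ} (hra : r ^ 2 = a) (hta : t ^ 2 = 1 - a)
    (hub : u ^ 2 = b) (hvb : v ^ 2 = 1 - b) {x : ℝ} (hx : 0 ≤ x) (h : √x ≤ r * u + t * v) :
    x ≤ fidelity (qubit a) (qubit b) := by
  refine le_fidelity_of_fromBlocks (Z := diagonal ![((r * u : ℝ) : ℂ), ((t * v : ℝ) : ℂ)]) hx ?_ ?_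
  · have h1 := posSemidef_self_mul_conjTranspose
      (fromRows (diagonal ![(r : ℂ), (t : ℂ)]) (diagonal ![(u : ℂ), (v : ℂ)]))
    refine posSemidef_of_eq h1 ?_
    rw [conjTranspose_fromRows_eq_fromCols_conjTranspose, fromRows_mul_fromCols, qubit, qubit,
      ← hta, ← hvb, ← hra, ← hub]
    congr 1 <;> ext i j <;> fin_cases i <;> fin_cases j <;>
      simp [diagonal_conjTranspose, pow_two, mul_comm]
  · simpa [trace_fin_two] using h

end Tightness

/-! ### Qubit pairs saturating the upper bounds. -/

section Tightness

lemma qubit_mem_ballP {ε μ : ℝ} (hμ : 0 < μ) (hμε : μ ≤ ε) (hε : ε < 1) :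
    qubit (μ ^ 2 / binaryFidelity (1 - ε) (ε - μ)) ∈ ballP (√(ε - μ)) (qubit ε) := by
  have a := Real.sq_sqrt (show 0 ≤ ε by linarith)
  have b := Real.sq_sqrt (show 0 ≤ 1 - ε by linarith)
  have c := Real.sq_sqrt (show 0 ≤ 1 - ε + μ by linarith)
  have d := Real.sq_sqrt (show 0 ≤ ε - μ by linarith)
  have hk := sqrt_rotation_mul hμ.le hμε hε.le
  have hF := binaryFidelity_pos hμ hμε hε.le
  have hq : (√ε * √(1 - ε + μ) - √(1 - ε) * √(ε - μ)) ^ 2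
      = μ ^ 2 / binaryFidelity (1 - ε) (ε - μ) := by
    rw [eq_div_iff hF.ne', binaryFidelity_eq hμ.le hμε hε.le, ← mul_pow, hk]
  set s := √ε
  set t := √(1 - ε)
  set x := √(1 - ε + μ) with hx
  set y := √(ε - μ)
  set q := μ ^ 2 / binaryFidelity (1 - ε) (ε - μ)
  have hq0 : 0 ≤ q := by rw [← hq]; positivity
  have hst : s ^ 2 + t ^ 2 = 1 := by linarith
  have hxy : x ^ 2 + y ^ 2 = 1 := by linarith
  -- The amplitudes of the second qubit are those of the first, `(s, t)`, rotated by the angle with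
  -- cosine `x` and sine `y`; their overlap is therefore exactly `x`.
  have hv : (s * y + t * x) ^ 2 = 1 - q := by
    have : (s * x - t * y) ^ 2 + (s * y + t * x) ^ 2 = (s ^ 2 + t ^ 2) * (x ^ 2 + y ^ 2) := by ring
    rw [hst, hxy] at this
    linarith
  have hq1 : q ≤ 1 := by nlinarith [sq_nonneg (s * y + t * x)]
  refine ⟨isState_qubit hq0 hq1, ?_⟩
  rw [purifiedDist_le_sqrt_iff (by linarith)]
  refine le_fidelity_qubit a b hq hv (by linarith) (le_of_eq ?_)
  rw [show 1 - (ε - μ) = 1 - ε + μ by ring, ← hx]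
  linear_combination -x * hst

lemma isState_qubit_one : IsState (qubit 1) := isState_qubit zero_le_one le_rfl

lemma qubit_one_le_one : qubit 1 ≤ 1 := by
  have h := (isState_qubit (le_refl (0 : ℝ)) zero_le_one).posSemidef
  refine posSemidef_of_eq h ?_
  rw [qubit, qubit]
  ext i j
  fin_cases i <;> fin_cases j <;> simp

lemma DH_qubit_of_mem_ballT {ε μ : ℝ} (hμ : 0 < μ) (hμε : μ ≤ ε) (hε : ε < 1) :
    DH (1 - ε) (qubit ε) (qubit μ) = (Real.logb 2 (1 / μ) : ℝ) := by
  have hs := isState_qubit (hμ.le.trans hμε) hε.le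
  exact DH_eq_logb hμ hs (fun N hN0 hN1 hN => le_trace_of_mem_ballTSub hN0 hN1 hN
    (ballT_subset_ballTSub _ hs (qubit_mem_ballT hμ.le hμε hε.le)))
    (nonneg_iff_posSemidef.2 isState_qubit_one.posSemidef) qubit_one_le_one
    (re_trace_qubit_mul ε).ge (re_trace_qubit_mul μ)

end Tightness

lemma binaryFidelity_le_one {p q : ℝ} (hp0 : 0 ≤ p) (hp1 : p ≤ 1) (hq0 : 0 ≤ q) (hq1 : q ≤ 1) :
    binaryFidelity p q ≤ 1 := by
  rw [binaryFidelity, Real.sqrt_mul hp0, Real.sqrt_mul (by linarith)]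
  have a := Real.sq_sqrt hp0
  have b := Real.sq_sqrt hq0
  have c := Real.sq_sqrt (sub_nonneg.2 hp1)
  have d := Real.sq_sqrt (sub_nonneg.2 hq1)
  have : (√p * √q + √(1 - p) * √(1 - q)) ^ 2 + (√p * √(1 - q) - √(1 - p) * √q) ^ 2
      = (√p ^ 2 + √(1 - p) ^ 2) * (√q ^ 2 + √(1 - q) ^ 2) := by ring
  rw [a, b, c, d] at this
  nlinarith [sq_nonneg (√p * √(1 - q) - √(1 - p) * √q)]

end OneShot

/-! ### Assembly of the bounds and of the saturating pairs. -/

theorem mainTheorem3 (ε μ : ℝ) (hμ : 0 < μ) (hμε : μ ≤ ε) (hε : ε < 1) :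
    -- bounds for all pairs of states on all finite-dimensional systems
    (∀ (n : Type*) [Fintype n] [DecidableEq n] (ρ σ : Matrix n n ℂ), IsState ρ → IsState σ →
      -- trace distance, normalised and subnormalised
      (DmaxT (Real.sqrt ε) ρ σ + (Real.logb 2 (1 / ε) : ℝ) ≤ DH (1 - ε) ρ σ ∧
        DH (1 - ε) ρ σ ≤ DmaxT (ε - μ) ρ σ + (Real.logb 2 (1 / μ) : ℝ)) ∧
      (DmaxTSub (Real.sqrt ε) ρ σ + (Real.logb 2 (1 / ε) : ℝ) ≤ DH (1 - ε) ρ σ ∧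
        DH (1 - ε) ρ σ ≤ DmaxTSub (ε - μ) ρ σ + (Real.logb 2 (1 / μ) : ℝ)) ∧
      -- purified distance, normalised and subnormalised
      (DmaxP (Real.sqrt ε) ρ σ + (Real.logb 2 (1 / ε) : ℝ) ≤ DH (1 - ε) ρ σ ∧
        DH (1 - ε) ρ σ ≤ DmaxP (Real.sqrt (ε - μ)) ρ σ
          + (Real.logb 2 (binaryFidelity (1 - ε) (ε - μ) / μ ^ 2) : ℝ) ∧
        DmaxP (Real.sqrt (ε - μ)) ρ σ
            + (Real.logb 2 (binaryFidelity (1 - ε) (ε - μ) / μ ^ 2) : ℝ)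
          ≤ DmaxP (Real.sqrt (ε - μ)) ρ σ + (Real.logb 2 (1 / μ ^ 2) : ℝ)) ∧
      (DmaxPSub (Real.sqrt ε) ρ σ + (Real.logb 2 (1 / ε) : ℝ) ≤ DH (1 - ε) ρ σ ∧
        DH (1 - ε) ρ σ ≤ DmaxPSub (Real.sqrt (ε - μ)) ρ σ
          + (Real.logb 2 (binaryFidelity (1 - ε) (ε - μ) / μ ^ 2) : ℝ) ∧
        DmaxPSub (Real.sqrt (ε - μ)) ρ σ
            + (Real.logb 2 (binaryFidelity (1 - ε) (ε - μ) / μ ^ 2) : ℝ)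
          ≤ DmaxPSub (Real.sqrt (ε - μ)) ρ σ + (Real.logb 2 (1 / μ ^ 2) : ℝ)) ∧
      -- commuting states, trace distance, normalised and subnormalised
      (Commute ρ σ →
        (DmaxT ε ρ σ + (Real.logb 2 (1 / ε) : ℝ) ≤ DH (1 - ε) ρ σ ∧
          DH (1 - ε) ρ σ ≤ DmaxT (ε - μ) ρ σ + (Real.logb 2 (1 / μ) : ℝ)) ∧
        (DmaxTSub ε ρ σ + (Real.logb 2 (1 / ε) : ℝ) ≤ DH (1 - ε) ρ σ ∧
          DH (1 - ε) ρ σ ≤ DmaxTSub (ε - μ) ρ σ + (Real.logb 2 (1 / μ) : ℝ)))) ∧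
    -- tightness: each normalised bound is saturated, with finite values, by a pair of qubit states
    (∃ ρ σ : Matrix (Fin 2) (Fin 2) ℂ, IsState ρ ∧ IsState σ ∧ DH (1 - ε) ρ σ ≠ ⊤ ∧
      DmaxT (Real.sqrt ε) ρ σ + (Real.logb 2 (1 / ε) : ℝ) = DH (1 - ε) ρ σ) ∧
    (∃ ρ σ : Matrix (Fin 2) (Fin 2) ℂ, IsState ρ ∧ IsState σ ∧ DH (1 - ε) ρ σ ≠ ⊤ ∧
      DH (1 - ε) ρ σ = DmaxT (ε - μ) ρ σ + (Real.logb 2 (1 / μ) : ℝ)) ∧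
    (∃ ρ σ : Matrix (Fin 2) (Fin 2) ℂ, IsState ρ ∧ IsState σ ∧ DH (1 - ε) ρ σ ≠ ⊤ ∧
      DmaxP (Real.sqrt ε) ρ σ + (Real.logb 2 (1 / ε) : ℝ) = DH (1 - ε) ρ σ) ∧
    (∃ ρ σ : Matrix (Fin 2) (Fin 2) ℂ, IsState ρ ∧ IsState σ ∧ DH (1 - ε) ρ σ ≠ ⊤ ∧
      DH (1 - ε) ρ σ = DmaxP (Real.sqrt (ε - μ)) ρ σ
        + (Real.logb 2 (binaryFidelity (1 - ε) (ε - μ) / μ ^ 2) : ℝ)) ∧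
    (∃ ρ σ : Matrix (Fin 2) (Fin 2) ℂ, IsState ρ ∧ IsState σ ∧ Commute ρ σ ∧
      DH (1 - ε) ρ σ ≠ ⊤ ∧
      DmaxT ε ρ σ + (Real.logb 2 (1 / ε) : ℝ) = DH (1 - ε) ρ σ) ∧
    (∃ ρ σ : Matrix (Fin 2) (Fin 2) ℂ, IsState ρ ∧ IsState σ ∧ Commute ρ σ ∧
      DH (1 - ε) ρ σ ≠ ⊤ ∧
      DH (1 - ε) ρ σ = DmaxT (ε - μ) ρ σ + (Real.logb 2 (1 / μ) : ℝ)) := by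
  have hε0 : 0 < ε := hμ.trans_le hμε
  have hF := binaryFidelity_pos hμ hμε hε.le
  have hκ : 0 < μ ^ 2 / binaryFidelity (1 - ε) (ε - μ) := by positivity
  have hlog : Real.logb 2 (1 / (μ ^ 2 / binaryFidelity (1 - ε) (ε - μ)))
      = Real.logb 2 (binaryFidelity (1 - ε) (ε - μ) / μ ^ 2) := by rw [one_div_div]
  have hlog_le : ((Real.logb 2 (binaryFidelity (1 - ε) (ε - μ) / μ ^ 2) : ℝ) : EReal)
      ≤ (Real.logb 2 (1 / μ ^ 2) : ℝ) := by
    refine EReal.coe_le_coe_iff.2 (Real.logb_le_logb_of_le (by norm_num) (by positivity) ?_)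
    gcongr
    exact binaryFidelity_le_one (by linarith) (by linarith) (by linarith) (by linarith)
  refine ⟨fun n _ _ ρ σ hρ hσ => ?_, ?_, ?_, ?_, ?_, ?_, ?_⟩
  · have hP : DmaxP (Real.sqrt ε) ρ σ + (Real.logb 2 (1 / ε) : ℝ) ≤ DH (1 - ε) ρ σ :=
      infDmax_add_le_DH hε0 hε.le hρ fun β hβ h => by
        obtain ⟨τ, hτ, hle⟩ := exists_mem_certifiedBall_le hε0 hε hβ hρ hσ h
        exact ⟨τ, certifiedBall_subset_ballP hε0.le hε.le ρ hτ, hle⟩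
    -- Enlarging the ball lowers the infimum: lower bounds pass from the smallest ball to larger
    -- ones, while upper bounds pass from subnormalised to normalised smoothing.
    have hT : DmaxT (Real.sqrt ε) ρ σ + (Real.logb 2 (1 / ε) : ℝ) ≤ DH (1 - ε) ρ σ :=
      (add_le_add_left (infDmax_anti (ballP_subset_ballT _ hρ) σ) _).trans hP
    have hTSub : DmaxTSub (Real.sqrt ε) ρ σ + (Real.logb 2 (1 / ε) : ℝ) ≤ DH (1 - ε) ρ σ :=
      (add_le_add_left (infDmax_anti (ballT_subset_ballTSub _ hρ) σ) _).trans hT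
    have hPSub : DmaxPSub (Real.sqrt ε) ρ σ + (Real.logb 2 (1 / ε) : ℝ) ≤ DH (1 - ε) ρ σ :=
      (add_le_add_left (infDmax_anti (ballP_subset_ballPSub _ ρ) σ) _).trans hP
    have uTSub : DH (1 - ε) ρ σ ≤ DmaxTSub (ε - μ) ρ σ + (Real.logb 2 (1 / μ) : ℝ) :=
      DH_le_infDmax_add hμ hρ fun τ hτ M hM0 hM1 hM => le_trace_of_mem_ballTSub hM0 hM1 hM hτ
    have uT : DH (1 - ε) ρ σ ≤ DmaxT (ε - μ) ρ σ + (Real.logb 2 (1 / μ) : ℝ) :=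
      uTSub.trans (add_le_add_left (infDmax_anti (ballT_subset_ballTSub _ hρ) σ) _)
    have uPSub : DH (1 - ε) ρ σ ≤ DmaxPSub (Real.sqrt (ε - μ)) ρ σ
        + (Real.logb 2 (binaryFidelity (1 - ε) (ε - μ) / μ ^ 2) : ℝ) := by
      rw [← hlog]
      exact DH_le_infDmax_add hκ hρ fun τ hτ M hM0 hM1 hM =>
        le_trace_of_mem_ballPSub hμ hμε hε hM0 hM1 hρ hM hτ
    have uP : DH (1 - ε) ρ σ ≤ DmaxP (Real.sqrt (ε - μ)) ρ σ
        + (Real.logb 2 (binaryFidelity (1 - ε) (ε - μ) / μ ^ 2) : ℝ) :=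
      uPSub.trans (add_le_add_left (infDmax_anti (ballP_subset_ballPSub _ ρ) σ) _)
    refine ⟨⟨hT, uT⟩, ⟨hTSub, uTSub⟩, ⟨hP, uP, add_le_add_right hlog_le _⟩,
      ⟨hPSub, uPSub, add_le_add_right hlog_le _⟩, fun hcomm => ?_⟩
    have cT : DmaxT ε ρ σ + (Real.logb 2 (1 / ε) : ℝ) ≤ DH (1 - ε) ρ σ :=
      infDmax_add_le_DH hε0 hε.le hρ fun β hβ h =>
        exists_mem_ballT_le_of_commute hε0 hε hβ hρ hσ hcomm h
    exact ⟨⟨cT, uT⟩, (add_le_add_left (infDmax_anti (ballT_subset_ballTSub _ hρ) σ) _).trans cT,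
      uTSub⟩
  · have hs := isState_qubit hε0.le hε.le
    refine ⟨qubit ε, qubit ε, hs, hs, ?_⟩
    rw [DH_self hε0 hε.le hs, DmaxT, infDmax_eq_zero (fun τ hτ => hτ.1)
      (ballP_subset_ballT _ hs (self_mem_ballP (Real.sqrt_nonneg ε) hs)), zero_add]
    exact ⟨EReal.coe_ne_top _, rfl⟩
  · have hs := isState_qubit hε0.le hε.le
    have hmem := qubit_mem_ballT hμ.le hμε hε.le
    refine ⟨qubit ε, qubit μ, hs, hmem.1, ?_⟩
    rw [DH_qubit_of_mem_ballT hμ hμε hε, DmaxT, infDmax_eq_zero (fun τ hτ => hτ.1) hmem, zero_add]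
    exact ⟨EReal.coe_ne_top _, rfl⟩
  · have hs := isState_qubit hε0.le hε.le
    refine ⟨qubit ε, qubit ε, hs, hs, ?_⟩
    rw [DH_self hε0 hε.le hs, DmaxP, infDmax_eq_zero (fun τ hτ => hτ.1)
      (self_mem_ballP (Real.sqrt_nonneg ε) hs), zero_add]
    exact ⟨EReal.coe_ne_top _, rfl⟩
  · have hs := isState_qubit hε0.le hε.le
    have hmem := qubit_mem_ballP hμ hμε hε
    have hDH := DH_eq_logb (ε := ε) hκ hs (fun N hN0 hN1 hN =>
      le_trace_of_mem_ballPSub hμ hμε hε hN0 hN1 hs hN (ballP_subset_ballPSub _ _ hmem))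
      (Matrix.nonneg_iff_posSemidef.2 isState_qubit_one.posSemidef) qubit_one_le_one
      (re_trace_qubit_mul ε).ge (re_trace_qubit_mul _)
    refine ⟨qubit ε, qubit (μ ^ 2 / binaryFidelity (1 - ε) (ε - μ)), hs, hmem.1, ?_⟩
    rw [hDH, hlog, DmaxP, infDmax_eq_zero (fun τ hτ => hτ.1) hmem, zero_add]
    exact ⟨EReal.coe_ne_top _, rfl⟩
  · have hs := isState_qubit hε0.le hε.le
    refine ⟨qubit ε, qubit ε, hs, hs, Commute.refl _, ?_⟩
    rw [DH_self hε0 hε.le hs, DmaxT, infDmax_eq_zero (fun τ hτ => hτ.1)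
      (ballP_subset_ballT _ hs (self_mem_ballP hε0.le hs)), zero_add]
    exact ⟨EReal.coe_ne_top _, rfl⟩
  · have hs := isState_qubit hε0.le hε.le
    have hmem := qubit_mem_ballT hμ.le hμε hε.le
    refine ⟨qubit ε, qubit μ, hs, hmem.1, commute_qubit ε μ, ?_⟩
    rw [DH_qubit_of_mem_ballT hμ hμε hε, DmaxT, infDmax_eq_zero (fun τ hτ => hτ.1) hmem, zero_add]
    exact ⟨EReal.coe_ne_top _, rfl⟩
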